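/- Let $n,k,t$ be positive integers with $3\le t\le k\le n$ and $n\ge (t+1)(k-t+1)$. Write $[n]=\{1,\dots,n\}$ and let $\binom{[n]}{k}$ denote the family of all $k$-element subsets of $[n]$. A family $\mathcal F$ of subsets of $[n]$ is called $t$-intersecting if $|F\cap F'|\ge t$ for all $F,F'\in\mathcal F$; two families $\mathcal A,\mathcal B$ are called cross-$t$-intersecting if $|A\cap B|\ge t$ for all $A\in\mathcal A$ and $B\in\mathcal B$. A maximum $t$-intersecting subfamily of $\binom{[n]}{k}$ is a $t$-intersecting subfamily of $\binom{[n]}{k}$ with the largest possible number of members. Let $\mathcal A,\mathcal B\subseteq\binom{[n]}{k}$ be cross-$t$-intersecting. Then $$|\mathcal A|\,|\mathcal B|\le\binom{n-t}{k-t}^2 ,$$ and equality holds if and only if $\mathcal A=\mathcal B$ and this family is a maximum $t$-intersecting subfamily of $\binom{[n]}{k}$. Moreover, if $n>(t+1)(k-t+1)$, then equality holds if and only if there is a $t$-element set $T\subseteq[n]$ such that $\mathcal A=\mathcal B=\{F\in\binom{[n]}{k}:T\subseteq F\}$ (a full $t$-star). -/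

import Mathlib

/-- `𝒜` and `ℬ` are cross-`t`-intersecting: `|A ∩ B| ≥ t` for all `A ∈ 𝒜` and `B ∈ ℬ`. -/
def CrossTIntersecting {n : ℕ} (t : ℕ) (𝒜 ℬ : Finset (Finset (Fin n))) : Prop :=
  ∀ A ∈ 𝒜, ∀ B ∈ ℬ, t ≤ (A ∩ B).card

/-- `ℱ` is `t`-intersecting: `|A ∩ B| ≥ t` for all `A, B ∈ ℱ`. -/
def TIntersecting {n : ℕ} (t : ℕ) (ℱ : Finset (Finset (Fin n))) : Prop :=
  ∀ A ∈ ℱ, ∀ B ∈ ℱ, t ≤ (A ∩ B).card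

/-- The family of all `k`-element subsets of the `n`-element ground set. -/
def kSubsets (n k : ℕ) : Finset (Finset (Fin n)) :=
  Finset.powersetCard k Finset.univ

/-- `ℱ` is a maximum `t`-intersecting subfamily of the family of all `k`-subsets: it is a
`t`-intersecting subfamily and no `t`-intersecting subfamily has more members. -/
def IsMaximumTIntersecting {n : ℕ} (k t : ℕ) (ℱ : Finset (Finset (Fin n))) : Prop :=
  ℱ ⊆ kSubsets n k ∧ TIntersecting t ℱ ∧
    ∀ 𝒢 : Finset (Finset (Fin n)), 𝒢 ⊆ kSubsets n k → TIntersecting t 𝒢 → 𝒢.card ≤ ℱ.card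

/-- The family of all `k`-subsets containing `T`; it is a full `t`-star when `|T| = t`. -/
def fullStar {n : ℕ} (k : ℕ) (T : Finset (Fin n)) : Finset (Finset (Fin n)) :=
  (kSubsets n k).filter fun A => T ⊆ A

/-! Since there are finitely many pairs, it suffices to classify the pairs of maximum product. For
`t < k` such a pair consists of two copies of one Frankl family, the `k`-sets meeting a fixed `(t +
2r)`-set in at least `t + r` points, with `r ≤ 1` (`MaxCrossPair.exists_frankl`). For `r = 0` this
is a full star; for `r = 1` it is no larger than a star, and as large only at the threshold `n = (t
+ 1)(k - t + 1)` (`card_frankl_one_le`). The case `k = t` is immediate.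

Shifting keeps a pair maximum, and a Frankl family can only come from a Frankl family
(`MaxCrossPair.frankl_of_shift`), so induction on the sum of all elements reduces to shifted pairs.
These are treated by generating sets in the manner of Ahlswede and Khachatrian. Let `Iic p` be the
shortest initial segment on which the traces decide membership in both families. If it has more than
`t` points, some generator of size `i` needs `p` (a pivot). Dropping `p` from the pivots of size `i`
enlarges one family; the cross property survives if the other family gives up the sets over its
pivots of size `j = p + 1 + t - i` (`cross_trade`).

Maximality applied to this trade and to its mirror image shows, for `t + 1 ≤ i ≤ j`, that the sets
over the pivots of size `i` make up at least a proportion `(t - 1)/t` of their family, strictly more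
when `j ≥ t + 2` (`ShiftedMaxPair.proportion`). Shiftedness bounds the same proportion by `i/(p +
1)` (`card_lower_mul_le`). As `t ≥ 3`, this leaves only `i = j = t + 1`, which is the Frankl family
with `r = 1`, and one sporadic case, `t = 3`, `p + 1 = 7`, `i = 5`, excluded by a finer count. -/

/-! ### Maximum pairs and Frankl families -/

/-- Two `k`-uniform cross-`t`-intersecting families whose product of sizes is largest possible. -/
structure MaxCrossPair {n : ℕ} (k t : ℕ) (𝒜 ℬ : Finset (Finset (Fin n))) : Prop where
  left : 𝒜 ⊆ kSubsets n k
  right : ℬ ⊆ kSubsets n k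
  cross : CrossTIntersecting t 𝒜 ℬ
  max : ∀ 𝒜' ℬ' : Finset (Finset (Fin n)), 𝒜' ⊆ kSubsets n k → ℬ' ⊆ kSubsets n k →
    CrossTIntersecting t 𝒜' ℬ' → 𝒜'.card * ℬ'.card ≤ 𝒜.card * ℬ.card

/-- The `k`-sets meeting `W` in at least `m` points. -/
def frankl {n : ℕ} (k m : ℕ) (W : Finset (Fin n)) : Finset (Finset (Fin n)) :=
  (kSubsets n k).filter fun F => m ≤ (F ∩ W).card

theorem mem_kSubsets {n k : ℕ} {F : Finset (Fin n)} : F ∈ kSubsets n k ↔ F.card = k := by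
  simp [kSubsets]

theorem mem_frankl {n k m : ℕ} {W F : Finset (Fin n)} :
    F ∈ frankl k m W ↔ F.card = k ∧ m ≤ (F ∩ W).card := by
  simp [frankl, mem_kSubsets]

theorem CrossTIntersecting.symm {n t : ℕ} {𝒜 ℬ : Finset (Finset (Fin n))}
    (h : CrossTIntersecting t 𝒜 ℬ) : CrossTIntersecting t ℬ 𝒜 := fun B hB A hA => by
  rw [Finset.inter_comm]; exact h A hA B hB

theorem MaxCrossPair.symm {n k t : ℕ} {𝒜 ℬ : Finset (Finset (Fin n))}
    (h : MaxCrossPair k t 𝒜 ℬ) : MaxCrossPair k t ℬ 𝒜 where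
  left := h.right
  right := h.left
  cross := h.cross.symm
  max := fun 𝒜' ℬ' h1 h2 h3 => by
    rw [mul_comm, mul_comm ℬ.card]; exact h.max ℬ' 𝒜' h2 h1 h3.symm

theorem frankl_cross {n k t r : ℕ} {W : Finset (Fin n)} (hW : W.card = t + 2 * r) :
    CrossTIntersecting t (frankl k (t + r) W) (frankl k (t + r) W) := by
  intro A hA B hB
  have h1 := (mem_frankl.1 hA).2
  have h2 := (mem_frankl.1 hB).2
  have h3 := Finset.card_union_add_card_inter (A ∩ W) (B ∩ W)
  have h4 : ((A ∩ W) ∪ (B ∩ W)).card ≤ W.card := Finset.card_le_card (by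
    intro x; simp only [Finset.mem_union, Finset.mem_inter]; tauto)
  have h5 : ((A ∩ W) ∩ (B ∩ W)).card ≤ (A ∩ B).card := Finset.card_le_card (by
    intro x; simp only [Finset.mem_inter]; tauto)
  omega

/-- The pair `(ℱ, ℱ)` competes with `(𝒜, ℬ)`, so neither inclusion can be strict. Positivity of the
product is what lets it control each factor. -/
theorem MaxCrossPair.eq_of_subset {n k t : ℕ} {𝒜 ℬ ℱ : Finset (Finset (Fin n))}
    (h : MaxCrossPair k t 𝒜 ℬ) (h0 : 0 < 𝒜.card * ℬ.card) (hℱ : ℱ ⊆ kSubsets n k)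
    (hc : CrossTIntersecting t ℱ ℱ) (h𝒜 : 𝒜 ⊆ ℱ) (hℬ : ℬ ⊆ ℱ) : 𝒜 = ℱ ∧ ℬ = ℱ := by
  have h1 := h.max ℱ ℱ hℱ hℱ hc
  have h2 := Finset.card_le_card h𝒜
  have h3 := Finset.card_le_card hℬ
  have h4 : 0 < 𝒜.card := Nat.pos_of_mul_pos_right h0
  have h5 : 0 < ℬ.card := Nat.pos_of_mul_pos_left h0
  constructor
  · exact Finset.eq_of_subset_of_card_le h𝒜 (by nlinarith)
  · exact Finset.eq_of_subset_of_card_le hℬ (by nlinarith)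

/-! ### Shifting -/

/-- Replace `b` by `a` in `F` whenever this is possible. -/
def push {n : ℕ} (a b : Fin n) (F : Finset (Fin n)) : Finset (Fin n) :=
  if b ∈ F ∧ a ∉ F then insert a (F.erase b) else F

/-- The map realizing the `(a, b)`-shift of the family `𝒜`. -/
def shiftMap {n : ℕ} (a b : Fin n) (𝒜 : Finset (Finset (Fin n))) (F : Finset (Fin n)) :
    Finset (Fin n) :=
  if push a b F ∈ 𝒜 then F else push a b F

/-- The `(a, b)`-shift of a family. -/
def shift {n : ℕ} (a b : Fin n) (𝒜 : Finset (Finset (Fin n))) : Finset (Finset (Fin n)) :=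
  𝒜.image (shiftMap a b 𝒜)

theorem push_of_mem {n : ℕ} {a b : Fin n} {F : Finset (Fin n)} (hb : b ∈ F) (ha : a ∉ F) :
    push a b F = insert a (F.erase b) := if_pos ⟨hb, ha⟩

theorem push_of_not {n : ℕ} {a b : Fin n} {F : Finset (Fin n)} (h : ¬ (b ∈ F ∧ a ∉ F)) :
    push a b F = F := if_neg h

theorem card_insert_erase {n : ℕ} {a b : Fin n} {F : Finset (Fin n)} (hb : b ∈ F) (ha : a ∉ F) :
    (insert a (F.erase b)).card = F.card := by
  rw [Finset.card_insert_of_notMem (by simp [ha]), Finset.card_erase_add_one hb]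

theorem card_push {n : ℕ} (a b : Fin n) (F : Finset (Fin n)) : (push a b F).card = F.card := by
  by_cases h : b ∈ F ∧ a ∉ F
  · rw [push_of_mem h.1 h.2, card_insert_erase h.1 h.2]
  · rw [push_of_not h]

theorem insert_erase_insert_erase {n : ℕ} {a b : Fin n} {F : Finset (Fin n)}
    (hb : b ∈ F) (ha : a ∉ F) : insert b ((insert a (F.erase b)).erase a) = F := by
  rw [Finset.erase_insert (by simp [ha]), Finset.insert_erase hb]

theorem shiftMap_injOn {n : ℕ} (a b : Fin n) (𝒜 : Finset (Finset (Fin n))) :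
    Set.InjOn (shiftMap a b 𝒜) 𝒜 := by
  intro F hF G hG h
  simp only [Finset.mem_coe] at hF hG
  unfold shiftMap at h
  split_ifs at h with h1 h2 h2
  · exact h
  · exact absurd (h ▸ hF) h2
  · exact absurd (h ▸ hG) h1
  · have h3 : b ∈ F ∧ a ∉ F := by
      by_contra h3; rw [push_of_not h3] at h1; exact h1 hF
    have h4 : b ∈ G ∧ a ∉ G := by
      by_contra h4; rw [push_of_not h4] at h2; exact h2 hG
    rw [push_of_mem h3.1 h3.2, push_of_mem h4.1 h4.2] at h
    rw [← insert_erase_insert_erase h3.1 h3.2, h, insert_erase_insert_erase h4.1 h4.2]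

theorem card_shift {n : ℕ} (a b : Fin n) (𝒜 : Finset (Finset (Fin n))) :
    (shift a b 𝒜).card = 𝒜.card := Finset.card_image_of_injOn (shiftMap_injOn a b 𝒜)

theorem shift_subset_kSubsets {n k : ℕ} {a b : Fin n} {𝒜 : Finset (Finset (Fin n))}
    (h : 𝒜 ⊆ kSubsets n k) : shift a b 𝒜 ⊆ kSubsets n k := by
  intro F hF
  obtain ⟨G, hG, rfl⟩ := Finset.mem_image.1 hF
  have h1 := mem_kSubsets.1 (h hG)
  rw [mem_kSubsets]
  unfold shiftMap
  split_ifs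
  · exact h1
  · rw [card_push, h1]

/-- A set that could be pushed but is still present was blocked by its own image, so both belong to
the original family. -/
theorem mem_of_mem_shift_right {n : ℕ} {a b : Fin n} {𝒜 : Finset (Finset (Fin n))}
    {F : Finset (Fin n)} (hF : F ∈ shift a b 𝒜) (hb : b ∈ F) (ha : a ∉ F) :
    F ∈ 𝒜 ∧ insert a (F.erase b) ∈ 𝒜 := by
  obtain ⟨G, hG, rfl⟩ := Finset.mem_image.1 hF
  unfold shiftMap at *
  split_ifs at * with h
  · rw [push_of_mem hb ha] at h; exact ⟨hG, h⟩
  · by_cases h3 : b ∈ G ∧ a ∉ G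
    · rw [push_of_mem h3.1 h3.2] at ha; simp at ha
    · rw [push_of_not h3] at h; exact absurd hG h

theorem mem_of_mem_shift_left {n : ℕ} {a b : Fin n} {𝒜 : Finset (Finset (Fin n))}
    {F : Finset (Fin n)} (hF : F ∈ shift a b 𝒜) (ha : a ∈ F) (hb : b ∉ F) :
    F ∈ 𝒜 ∨ insert b (F.erase a) ∈ 𝒜 := by
  obtain ⟨G, hG, rfl⟩ := Finset.mem_image.1 hF
  unfold shiftMap at *
  split_ifs at * with h
  · exact Or.inl hG
  · by_cases h3 : b ∈ G ∧ a ∉ G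
    · rw [push_of_mem h3.1 h3.2, insert_erase_insert_erase h3.1 h3.2]; exact Or.inr hG
    · rw [push_of_not h3] at h; exact absurd hG h

theorem mem_of_mem_shift_iff {n : ℕ} {a b : Fin n} {𝒜 : Finset (Finset (Fin n))}
    {F : Finset (Fin n)} (hab : a ≠ b) (hF : F ∈ shift a b 𝒜) (h : a ∈ F ↔ b ∈ F) : F ∈ 𝒜 := by
  obtain ⟨G, hG, rfl⟩ := Finset.mem_image.1 hF
  unfold shiftMap at *
  split_ifs at * with h1
  · exact hG
  · by_cases h3 : b ∈ G ∧ a ∉ G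
    · rw [push_of_mem h3.1 h3.2] at h; simp [hab.symm] at h
    · rw [push_of_not h3]; exact hG

/-- Isolates the contribution of `a` and `b`, the only points a shift can affect. -/
theorem card_inter_eq {n : ℕ} {a b : Fin n} (hab : a ≠ b) (F G : Finset (Fin n)) :
    (F ∩ G).card = ((F \ {a, b}) ∩ (G \ {a, b})).card + (if a ∈ F ∧ a ∈ G then 1 else 0) +
      (if b ∈ F ∧ b ∈ G then 1 else 0) := by
  have h1 : (F ∩ G).card = ((F ∩ G) \ {a, b}).card + ((F ∩ G) ∩ {a, b}).card :=
    (Finset.card_sdiff_add_card_inter _ _).symm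
  have h2 : (F ∩ G) \ {a, b} = (F \ {a, b}) ∩ (G \ {a, b}) := by
    ext x; simp only [Finset.mem_sdiff, Finset.mem_inter]; tauto
  rw [h1, h2, add_assoc]
  congr 1
  rw [Finset.inter_comm, ← Finset.filter_mem_eq_inter, Finset.card_filter, Finset.sum_pair hab]
  simp only [Finset.mem_inter]

theorem insert_erase_sdiff {n : ℕ} {a b : Fin n} (F : Finset (Fin n)) :
    (insert a (F.erase b)) \ {a, b} = F \ {a, b} := by
  ext x; simp only [Finset.mem_sdiff, Finset.mem_insert, Finset.mem_erase, Finset.mem_singleton]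
  tauto

/-- For `F` and `G` in the shifted families there are originals that agree with them off `{a, b}`
and share no more points of `{a, b}`. The delicate case is an `F` that received `a` in exchange for
`b`, against a `G` with `b ∈ G` and `a ∉ G`: then `G` was blocked, and its blocking image is the
partner to use. -/
theorem shift_cross {n t : ℕ} {a b : Fin n} (hab : a ≠ b) {𝒜 ℬ : Finset (Finset (Fin n))}
    (h : CrossTIntersecting t 𝒜 ℬ) : CrossTIntersecting t (shift a b 𝒜) (shift a b ℬ) := by
  intro F hF G hG
  have key : ∀ F' ∈ 𝒜, ∀ G' ∈ ℬ, F' \ {a, b} = F \ {a, b} → G' \ {a, b} = G \ {a, b} →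
      ((if a ∈ F' ∧ a ∈ G' then 1 else 0) + (if b ∈ F' ∧ b ∈ G' then 1 else 0) ≤
        (if a ∈ F ∧ a ∈ G then 1 else 0) + (if b ∈ F ∧ b ∈ G then 1 else 0)) →
      t ≤ (F ∩ G).card := by
    intro F' hF' G' hG' h1 h2 h3
    have h4 := h F' hF' G' hG'
    rw [card_inter_eq hab, h1, h2] at h4
    rw [card_inter_eq hab]
    omega
  have eF := insert_erase_sdiff (a := a) (b := b) F
  have eG := insert_erase_sdiff (a := a) (b := b) G
  have eF' : (insert b (F.erase a)) \ {a, b} = F \ {a, b} := by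
    rw [Finset.pair_comm]; exact insert_erase_sdiff F
  have eG' : (insert b (G.erase a)) \ {a, b} = G \ {a, b} := by
    rw [Finset.pair_comm]; exact insert_erase_sdiff G
  have hba := hab.symm
  by_cases aF : a ∈ F <;> by_cases bF : b ∈ F <;> by_cases aG : a ∈ G <;> by_cases bG : b ∈ G
  all_goals
    first
      | have hF1 := mem_of_mem_shift_iff hab hF (by tauto)
      | have hF1 := mem_of_mem_shift_left hF aF bF
      | have hF1 := mem_of_mem_shift_right hF bF aF
  all_goals
    first
      | have hG1 := mem_of_mem_shift_iff hab hG (by tauto)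
      | have hG1 := mem_of_mem_shift_left hG aG bG
      | have hG1 := mem_of_mem_shift_right hG bG aG
  all_goals
    first
      | exact key _ hF1 _ hG1 rfl rfl le_rfl
      | exact key _ hF1.1 _ hG1 rfl rfl le_rfl
      | exact key _ hF1 _ hG1.1 rfl rfl le_rfl
      | exact key _ hF1.1 _ hG1.1 rfl rfl le_rfl
      | (rcases hF1 with hF1 | hF1 <;> rcases hG1 with hG1 | hG1
         · exact key _ hF1 _ hG1 rfl rfl le_rfl
         · exact key _ hF1 _ hG1 rfl eG' (by simp [*])
         · exact key _ hF1 _ hG1 eF' rfl (by simp [*])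
         · exact key _ hF1 _ hG1 eF' eG' (by simp [*]))
      | (rcases hF1 with hF1 | hF1
         · first
            | exact key _ hF1 _ hG1 rfl rfl le_rfl
            | exact key _ hF1 _ hG1.1 rfl rfl le_rfl
         · first
            | exact key _ hF1 _ hG1 eF' rfl (by simp [*])
            | exact key _ hF1 _ hG1.2 eF' eG (by simp [*]))
      | (rcases hG1 with hG1 | hG1
         · first
            | exact key _ hF1 _ hG1 rfl rfl le_rfl
            | exact key _ hF1.1 _ hG1 rfl rfl le_rfl
         · first
            | exact key _ hF1 _ hG1 rfl eG' (by simp [*])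
            | exact key _ hF1.2 _ hG1 eF eG' (by simp [*]))

theorem MaxCrossPair.map_shift {n k t : ℕ} {a b : Fin n} (hab : a ≠ b)
    {𝒜 ℬ : Finset (Finset (Fin n))} (h : MaxCrossPair k t 𝒜 ℬ) :
    MaxCrossPair k t (shift a b 𝒜) (shift a b ℬ) where
  left := shift_subset_kSubsets h.left
  right := shift_subset_kSubsets h.right
  cross := shift_cross hab h.cross
  max := by rw [card_shift, card_shift]; exact h.max

/-- Stability under all shifts towards smaller elements. -/
def Shifted {n : ℕ} (𝒜 : Finset (Finset (Fin n))) : Prop :=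
  ∀ a b : Fin n, a < b → ∀ F ∈ 𝒜, b ∈ F → a ∉ F → insert a (F.erase b) ∈ 𝒜

/-- The sum of all elements of all members of a family. -/
def weight {n : ℕ} (𝒜 : Finset (Finset (Fin n))) : ℕ := ∑ F ∈ 𝒜, ∑ x ∈ F, x.val

theorem sum_push_lt {n : ℕ} {a b : Fin n} (hab : a < b) {F : Finset (Fin n)}
    (hb : b ∈ F) (ha : a ∉ F) : ∑ x ∈ insert a (F.erase b), x.val < ∑ x ∈ F, x.val := by
  rw [Finset.sum_insert (by simp [ha]), ← Finset.add_sum_erase F _ hb]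
  have : a.val < b.val := hab
  omega

theorem sum_shiftMap_le {n : ℕ} {a b : Fin n} (hab : a < b) (𝒜 : Finset (Finset (Fin n)))
    (F : Finset (Fin n)) : ∑ x ∈ shiftMap a b 𝒜 F, x.val ≤ ∑ x ∈ F, x.val := by
  unfold shiftMap
  split_ifs with h
  · exact le_rfl
  · by_cases h3 : b ∈ F ∧ a ∉ F
    · rw [push_of_mem h3.1 h3.2]; exact (sum_push_lt hab h3.1 h3.2).le
    · rw [push_of_not h3]

theorem weight_shift_le {n : ℕ} {a b : Fin n} (hab : a < b) (𝒜 : Finset (Finset (Fin n))) :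
    weight (shift a b 𝒜) ≤ weight 𝒜 := by
  unfold weight shift
  rw [Finset.sum_image (shiftMap_injOn a b 𝒜)]
  exact Finset.sum_le_sum fun F _ => sum_shiftMap_le hab 𝒜 F

theorem weight_shift_lt {n : ℕ} {a b : Fin n} (hab : a < b) {𝒜 : Finset (Finset (Fin n))}
    {F : Finset (Fin n)} (hF : F ∈ 𝒜) (hb : b ∈ F) (ha : a ∉ F)
    (h : insert a (F.erase b) ∉ 𝒜) : weight (shift a b 𝒜) < weight 𝒜 := by
  unfold weight shift
  rw [Finset.sum_image (shiftMap_injOn a b 𝒜)]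
  refine Finset.sum_lt_sum (fun F _ => sum_shiftMap_le hab 𝒜 F) ⟨F, hF, ?_⟩
  rw [shiftMap, push_of_mem hb ha, if_neg h]
  exact sum_push_lt hab hb ha

/-- A set can be extended to any feasible prescribed size without enlarging its intersection with
`D`. -/
theorem exists_extension {n m : ℕ} {E D : Finset (Fin n)} (hE : E.card ≤ m)
    (h : (E ∪ D).card + (m - E.card) ≤ n) :
    ∃ F : Finset (Fin n), E ⊆ F ∧ F.card = m ∧ F ∩ D = E ∩ D := by
  have h1 : m - E.card ≤ ((E ∪ D)ᶜ).card := by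
    rw [Finset.card_compl, Fintype.card_fin]; omega
  obtain ⟨U, hU, hc⟩ := Finset.exists_subset_card_eq h1
  have h2 : ∀ x ∈ U, x ∉ E ∧ x ∉ D := fun x hx => by
    have := hU hx; simpa [not_or] using this
  refine ⟨E ∪ U, Finset.subset_union_left, ?_, ?_⟩
  · rw [Finset.card_union_of_disjoint, hc]
    · omega
    · exact Finset.disjoint_left.2 fun x hx hx' => (h2 x hx').1 hx
  · ext x
    simp only [Finset.mem_inter, Finset.mem_union]
    constructor
    · rintro ⟨h3 | h3, h4⟩
      · exact ⟨h3, h4⟩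
      · exact absurd h4 (h2 x h3).2
    · rintro ⟨h3, h4⟩; exact ⟨Or.inl h3, h4⟩

/-! ### Undoing a shift that ends in a Frankl family -/

/-- A family whose shift lies in a Frankl family lies there itself, provided that the members which
the shift would push into the boundary layer are left in place. -/
theorem subset_frankl_of_shift {n k m : ℕ} {a b : Fin n} {𝒜 : Finset (Finset (Fin n))}
    {W : Finset (Fin n)} (h𝒜 : 𝒜 ⊆ kSubsets n k) (hs : shift a b 𝒜 ⊆ frankl k m W)
    (h : ∀ F ∈ 𝒜, b ∈ F → a ∉ F → a ∈ W → b ∉ W → (F ∩ W).card + 1 = m →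
      insert a (F.erase b) ∈ 𝒜) : 𝒜 ⊆ frankl k m W := by
  intro F hF
  have h1 : shiftMap a b 𝒜 F ∈ frankl k m W := hs (Finset.mem_image_of_mem _ hF)
  unfold shiftMap at h1
  split_ifs at h1 with h2
  · exact h1
  · by_cases h3 : b ∈ F ∧ a ∉ F
    · rw [push_of_mem h3.1 h3.2] at h1 h2
      refine mem_frankl.2 ⟨mem_kSubsets.1 (h𝒜 hF), ?_⟩
      have h4 := (mem_frankl.1 h1).2
      by_contra h5
      have hab : a ≠ b := fun e => h3.2 (e ▸ h3.1)
      rw [card_inter_eq hab, insert_erase_sdiff] at h4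
      have h6 := card_inter_eq hab F W
      simp only [h3.1, h3.2, true_and, false_and, Finset.mem_insert, Finset.mem_erase, true_or,
        hab.symm, ne_eq, not_true_eq_false, or_self, if_false, add_zero] at h4 h6
      split_ifs at h4 h6 with h7 h8 h8
      · omega
      · exact h2 (h F hF h3.1 h3.2 h7 h8 (by omega))
      · omega
      · omega
    · rwa [push_of_not h3] at h1

/-- As `subset_frankl_of_shift`, for the set obtained from `W` by replacing `a` by `b`. -/
theorem subset_frankl_swap_of_shift {n k m : ℕ} {a b : Fin n} {𝒜 : Finset (Finset (Fin n))}
    {W : Finset (Fin n)} (hab : a ≠ b) (ha : a ∈ W) (hb : b ∉ W) (h𝒜 : 𝒜 ⊆ kSubsets n k)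
    (hs : shift a b 𝒜 ⊆ frankl k m W)
    (h : ∀ F ∈ 𝒜, a ∈ F → b ∉ F → (F ∩ W).card ≠ m) :
    𝒜 ⊆ frankl k m (insert b (W.erase a)) := by
  intro F hF
  have h1 : shiftMap a b 𝒜 F ∈ frankl k m W := hs (Finset.mem_image_of_mem _ hF)
  refine mem_frankl.2 ⟨mem_kSubsets.1 (h𝒜 hF), ?_⟩
  have hW : (insert b (W.erase a)) \ {a, b} = W \ {a, b} := by
    rw [Finset.pair_comm]; exact insert_erase_sdiff W
  rw [card_inter_eq hab, hW]
  have h6 := card_inter_eq hab F W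
  have h7 := card_inter_eq hab (insert a (F.erase b)) W
  rw [insert_erase_sdiff] at h7
  unfold shiftMap at h1
  by_cases h3 : b ∈ F ∧ a ∉ F
  · rw [push_of_mem h3.1 h3.2] at h1
    simp only [h3.1, h3.2, ha, hb, hab, hab.symm, Finset.mem_insert, Finset.mem_erase, and_false,
      true_or, and_true, if_true, if_false, or_self, ne_eq, not_true_eq_false] at h6 h7 ⊢
    split_ifs at h1
    · have := (mem_frankl.1 h1).2; omega
    · have := (mem_frankl.1 h1).2; omega
  · rw [push_of_not h3, ite_self] at h1
    have h4 := (mem_frankl.1 h1).2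
    have h5 := h F hF
    by_cases aF : a ∈ F <;> by_cases bF : b ∈ F <;>
      simp only [aF, bF, ha, hb, hab, hab.symm, Finset.mem_insert, Finset.mem_erase, and_false,
        true_or, and_true, if_true, if_false, or_self, ne_eq, not_true_eq_false,
        not_false_eq_true, forall_true_left] at h3 h5 h6 ⊢ <;> omega

/-- In the boundary layer of a Frankl family, membership is transferred between the two families
along pairs meeting in exactly `t` elements. -/
theorem boundary_transfer {n k t m : ℕ} {a b : Fin n} {𝒜 ℬ : Finset (Finset (Fin n))}
    {W : Finset (Fin n)} (hc : CrossTIntersecting t 𝒜 ℬ) (hs : frankl k m W ⊆ shift a b ℬ)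
    {G G' : Finset (Fin n)} (hG : G ∈ 𝒜) (haG : a ∈ G) (hbG : b ∉ G)
    (hG' : G' ∈ frankl k m W) (haG' : a ∈ G') (hbG' : b ∉ G') (h : (G ∩ G').card = t) :
    G' ∈ ℬ := by
  have hab : a ≠ b := fun e => hbG (e ▸ haG)
  rcases mem_of_mem_shift_left (hs hG') haG' hbG' with h1 | h1
  · exact h1
  -- Otherwise the preimage of `G'`, with `b` in place of `a`, lies in `ℬ` and loses the common
  -- point `a`, so it meets `G` in only `t - 1` points.
  · exfalso
    have h2 := hc G hG _ h1
    have h3 := card_inter_eq hab G G'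
    have e : (insert b (G'.erase a)) \ {a, b} = G' \ {a, b} := by
      rw [Finset.pair_comm]; exact insert_erase_sdiff G'
    rw [card_inter_eq hab, e] at h2
    simp only [haG, hbG, haG', hab, hab.symm, Finset.mem_insert, Finset.mem_erase,
        false_and, and_false, true_or, and_true, if_true, if_false, or_self, ne_eq,
        not_true_eq_false] at h2 h3
    omega

/-- Any two boundary sets have a common neighbour: a boundary set meeting both in `t` elements. -/
theorem exists_boundary_common {n k t r : ℕ} {a b : Fin n} {W : Finset (Fin n)}
    (ha : a ∈ W) (hb : b ∉ W) (hW : W.card = t + 2 * r) (hr : r + 1 ≤ t) (hk : t + r ≤ k)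
    (hn : 3 * (k - t - r) + t + 2 * r + 1 ≤ n) {G₁ G₂ : Finset (Fin n)}
    (h1 : G₁.card = k) (h1W : (G₁ ∩ W).card = t + r)
    (h2 : G₂.card = k) (h2W : (G₂ ∩ W).card = t + r) :
    ∃ G : Finset (Fin n), G.card = k ∧ a ∈ G ∧ b ∉ G ∧ (G ∩ W).card = t + r ∧
      (G₁ ∩ G).card = t ∧ (G₂ ∩ G).card = t := by
  have c1 : (W \ G₁).card = r := by
    have := Finset.card_sdiff_add_card_inter W G₁
    rw [Finset.inter_comm] at this; omega
  have c2 : (W \ G₂).card = r := by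
    have := Finset.card_sdiff_add_card_inter W G₂
    rw [Finset.inter_comm] at this; omega
  have d1 : (G₁ \ W).card = k - t - r := by
    have := Finset.card_sdiff_add_card_inter G₁ W; omega
  have d2 : (G₂ \ W).card = k - t - r := by
    have := Finset.card_sdiff_add_card_inter G₂ W; omega
  -- The common neighbour is `W \ M ∪ U`. Of the `t + 2r - 1` points of `W` other than `a`, at most
  -- `2r` are missed by `G₁` or `G₂`, and `r + 1 ≤ t` leaves room for `M`.
  obtain ⟨M, hM, hMc⟩ : ∃ M ⊆ (W.erase a) \ ((W \ G₁) ∪ (W \ G₂)), M.card = r := by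
    apply Finset.exists_subset_card_eq
    have e1 := Finset.le_card_sdiff ((W \ G₁) ∪ (W \ G₂)) (W.erase a)
    have e2 := Finset.card_union_le (W \ G₁) (W \ G₂)
    rw [Finset.card_erase_of_mem ha] at e1
    omega
  -- `U` avoids `b`, `W` and the `k - t - r` points that each of `G₁`, `G₂` has outside `W`;
  -- together with `U` itself this accounts for `hn`.
  obtain ⟨U, hU, hUc⟩ : ∃ U ⊆ (insert b (W ∪ ((G₁ \ W) ∪ (G₂ \ W))))ᶜ, U.card = k - t - r := by
    apply Finset.exists_subset_card_eq
    have e1 := Finset.card_insert_le b (W ∪ ((G₁ \ W) ∪ (G₂ \ W)))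
    have e2 := Finset.card_union_le W ((G₁ \ W) ∪ (G₂ \ W))
    have e3 := Finset.card_union_le (G₁ \ W) (G₂ \ W)
    rw [Finset.card_compl, Fintype.card_fin]
    omega
  have hM' : ∀ x ∈ M, x ≠ a ∧ x ∈ W ∧ x ∈ G₁ ∧ x ∈ G₂ := fun x hx => by
    have := hM hx
    simp only [Finset.mem_sdiff, Finset.mem_erase, Finset.mem_union] at this
    tauto
  have hU' : ∀ x ∈ U, x ≠ b ∧ x ∉ W ∧ x ∉ G₁ ∧ x ∉ G₂ := fun x hx => by
    have := hU hx
    simp only [Finset.mem_compl, Finset.mem_insert, Finset.mem_sdiff, Finset.mem_union] at this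
    tauto
  have hMW : M ⊆ W := fun x hx => (hM' x hx).2.1
  have hWM : (W \ M).card = t + r := by
    rw [Finset.card_sdiff_of_subset hMW]; omega
  have inter : ∀ G' : Finset (Fin n), (G' ∩ W).card = t + r → M ⊆ G' → (∀ x ∈ U, x ∉ G') →
      (G' ∩ (W \ M ∪ U)).card = t := by
    intro G' h3 h4 h5
    have h6 : G' ∩ (W \ M ∪ U) = (G' ∩ W) \ M := by
      ext x; simp only [Finset.mem_inter, Finset.mem_union, Finset.mem_sdiff]
      have := h5 x; tauto
    rw [h6, Finset.card_sdiff_of_subset (Finset.subset_inter h4 hMW)]; omega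
  refine ⟨W \ M ∪ U, ?_, ?_, ?_, ?_, ?_, ?_⟩
  · rw [Finset.card_union_of_disjoint, hWM, hUc]
    · omega
    · exact Finset.disjoint_left.2 fun x hx hx' => (hU' x hx').2.1 (Finset.mem_sdiff.1 hx).1
  · exact Finset.mem_union_left _ (Finset.mem_sdiff.2 ⟨ha, fun h => (hM' a h).1 rfl⟩)
  · intro h
    rcases Finset.mem_union.1 h with h | h
    · exact hb (Finset.mem_sdiff.1 h).1
    · exact (hU' b h).1 rfl
  · rw [← hWM]; congr 1
    ext x; simp only [Finset.mem_inter, Finset.mem_union, Finset.mem_sdiff]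
    have := hU' x; tauto
  · exact inter G₁ h1W (fun x hx => (hM' x hx).2.2.1) fun x hx => (hU' x hx).2.2.1
  · exact inter G₂ h2W (fun x hx => (hM' x hx).2.2.2) fun x hx => (hU' x hx).2.2.2

/-- If shifting turns a maximum pair into a Frankl family, then the pair itself is a Frankl
family. -/
theorem MaxCrossPair.frankl_of_shift {n k t r : ℕ} {a b : Fin n} {𝒜 ℬ : Finset (Finset (Fin n))}
    {W : Finset (Fin n)} (hmax : MaxCrossPair k t 𝒜 ℬ) (h0 : 0 < 𝒜.card * ℬ.card)
    (hab : a ≠ b) (hW : W.card = t + 2 * r) (hr : r + 1 ≤ t) (hk : t + r ≤ k)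
    (hn : 3 * (k - t - r) + t + 2 * r + 1 ≤ n)
    (h𝒜 : shift a b 𝒜 = frankl k (t + r) W) (hℬ : shift a b ℬ = frankl k (t + r) W) :
    ∃ W' : Finset (Fin n), W'.card = t + 2 * r ∧ 𝒜 = frankl k (t + r) W' ∧
      ℬ = frankl k (t + r) W' := by
  have fin : ∀ W' : Finset (Fin n), W'.card = t + 2 * r → 𝒜 ⊆ frankl k (t + r) W' →
      ℬ ⊆ frankl k (t + r) W' → ∃ W' : Finset (Fin n), W'.card = t + 2 * r ∧
      𝒜 = frankl k (t + r) W' ∧ ℬ = frankl k (t + r) W' := fun W' h1 h2 h3 =>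
    ⟨W', h1, hmax.eq_of_subset h0 (Finset.filter_subset _ _) (frankl_cross h1) h2 h3⟩
  -- Only when `a ∈ W` and `b ∉ W` can a push increase the trace on `W`.
  by_cases hw : a ∈ W ∧ b ∉ W
  swap
  · exact fin W hW (subset_frankl_of_shift hmax.left h𝒜.subset fun _ _ _ _ h1 h2 => absurd ⟨h1, h2⟩ hw)
      (subset_frankl_of_shift hmax.right hℬ.subset fun _ _ _ _ h1 h2 => absurd ⟨h1, h2⟩ hw)
  obtain ⟨ha, hb⟩ := hw
  -- All or nothing: common neighbours connect all boundary sets containing `a` but not `b`, so a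
  -- single one of them in `𝒳` forces every one into both families.
  have spread : ∀ 𝒳 𝒴 : Finset (Finset (Fin n)), 𝒳 ⊆ kSubsets n k → CrossTIntersecting t 𝒳 𝒴 →
      shift a b 𝒳 = frankl k (t + r) W → shift a b 𝒴 = frankl k (t + r) W →
      (∃ G ∈ 𝒳, a ∈ G ∧ b ∉ G ∧ (G ∩ W).card = t + r) →
      ∀ G : Finset (Fin n), G.card = k → a ∈ G → b ∉ G → (G ∩ W).card = t + r →
        G ∈ 𝒳 ∧ G ∈ 𝒴 := by
    intro 𝒳 𝒴 hX hc hX' hY' hG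
    have to_left : ∀ G : Finset (Fin n), G.card = k → a ∈ G → b ∉ G → (G ∩ W).card = t + r →
        G ∈ 𝒳 := by
      obtain ⟨G₁, hG₁, a1, b1, w1⟩ := hG
      intro G₂ c2 a2 b2 w2
      have c1 := mem_kSubsets.1 (hX hG₁)
      obtain ⟨G₃, c3, a3, b3, w3, i1, i2⟩ :=
        exists_boundary_common ha hb hW hr hk hn c1 w1 c2 w2
      have h3 : G₃ ∈ 𝒴 := boundary_transfer hc hY'.symm.subset hG₁ a1 b1
        (mem_frankl.2 ⟨c3, w3.ge⟩) a3 b3 i1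
      exact boundary_transfer hc.symm hX'.symm.subset h3 a3 b3
        (mem_frankl.2 ⟨c2, w2.ge⟩) a2 b2 (by rw [Finset.inter_comm]; exact i2)
    intro G c1 a1 b1 w1
    refine ⟨to_left G c1 a1 b1 w1, ?_⟩
    obtain ⟨G₃, c3, a3, b3, w3, i1, -⟩ :=
        exists_boundary_common ha hb hW hr hk hn c1 w1 c1 w1
    exact boundary_transfer hc hY'.symm.subset (to_left G₃ c3 a3 b3 w3) a3 b3
        (mem_frankl.2 ⟨c1, w1.ge⟩) a1 b1 (by rw [Finset.inter_comm]; exact i1)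
  have stay : ∀ 𝒳 : Finset (Finset (Fin n)), 𝒳 ⊆ kSubsets n k →
      shift a b 𝒳 = frankl k (t + r) W →
      (∀ G : Finset (Fin n), G.card = k → a ∈ G → b ∉ G → (G ∩ W).card = t + r → G ∈ 𝒳) →
      𝒳 ⊆ frankl k (t + r) W := by
    intro 𝒳 hX hX' h
    refine subset_frankl_of_shift hX hX'.subset fun F hF bF aF _ _ hFW => ?_
    refine h _ (by rw [card_insert_erase bF aF]; exact mem_kSubsets.1 (hX hF))
      (Finset.mem_insert_self _ _) (by simp [hab.symm]) ?_
    have h6 := card_inter_eq hab F W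
    rw [card_inter_eq hab, insert_erase_sdiff]
    simp only [aF, bF, ha, hb, hab.symm, Finset.mem_insert, Finset.mem_erase,
        and_false, true_or, and_true, if_true, if_false, or_self, ne_eq,
        not_true_eq_false] at h6 ⊢
    omega
  by_cases hG : ∃ G ∈ 𝒜, a ∈ G ∧ b ∉ G ∧ (G ∩ W).card = t + r
  · have h1 := spread 𝒜 ℬ hmax.left hmax.cross h𝒜 hℬ hG
    exact fin W hW (stay 𝒜 hmax.left h𝒜 fun G c1 a1 b1 w1 => (h1 G c1 a1 b1 w1).1)
      (stay ℬ hmax.right hℬ fun G c1 a1 b1 w1 => (h1 G c1 a1 b1 w1).2)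
  · have hG' : ¬ ∃ G ∈ ℬ, a ∈ G ∧ b ∉ G ∧ (G ∩ W).card = t + r := by
      rintro ⟨G, hG1, a1, b1, w1⟩
      have h1 := spread ℬ 𝒜 hmax.right hmax.cross.symm hℬ h𝒜 ⟨G, hG1, a1, b1, w1⟩ G
        (mem_kSubsets.1 (hmax.right hG1)) a1 b1 w1
      exact hG ⟨G, h1.2, a1, b1, w1⟩
    -- No boundary set with `a` and without `b` was present before the shift, so `b` plays the part
    -- of `a` in the original pair.
    refine fin (insert b (W.erase a)) (by rw [card_insert_erase ha hb, hW]) ?_ ?_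
    · exact subset_frankl_swap_of_shift hab ha hb hmax.left h𝒜.subset
        fun F hF aF bF hFW => hG ⟨F, hF, aF, bF, hFW⟩
    · exact subset_frankl_swap_of_shift hab ha hb hmax.right hℬ.subset
        fun F hF aF bF hFW => hG' ⟨F, hF, aF, bF, hFW⟩

/-! ### Generators -/

/-- The sets of size at most `k` all of whose `k`-supersets belong to `𝒜`. -/
def gen {n : ℕ} (k : ℕ) (𝒜 : Finset (Finset (Fin n))) : Finset (Finset (Fin n)) :=
  Finset.univ.filter fun E => E.card ≤ k ∧ ∀ F : Finset (Fin n), F.card = k → E ⊆ F → F ∈ 𝒜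

theorem mem_gen {n k : ℕ} {𝒜 : Finset (Finset (Fin n))} {E : Finset (Fin n)} :
    E ∈ gen k 𝒜 ↔ E.card ≤ k ∧ ∀ F : Finset (Fin n), F.card = k → E ⊆ F → F ∈ 𝒜 := by
  simp [gen]

theorem gen_mono {n k : ℕ} {𝒜 : Finset (Finset (Fin n))} {E E' : Finset (Fin n)}
    (hE : E ∈ gen k 𝒜) (h : E ⊆ E') (hk : E'.card ≤ k) : E' ∈ gen k 𝒜 :=
  mem_gen.2 ⟨hk, fun F hF hE' => (mem_gen.1 hE).2 F hF (h.trans hE')⟩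

/-- A `k`-set over the shifted generator either contains `b`, hence the generator itself, or is the
shift of a `k`-set over the generator. -/
theorem gen_shifted {n k : ℕ} {𝒜 : Finset (Finset (Fin n))} (h : Shifted 𝒜) :
    Shifted (gen k 𝒜) := by
  intro a b hab E hE hb ha
  obtain ⟨h1, h2⟩ := mem_gen.1 hE
  refine mem_gen.2 ⟨by rwa [card_insert_erase hb ha], fun F hF hEF => ?_⟩
  have haF : a ∈ F := hEF (Finset.mem_insert_self _ _)
  have hsub : E.erase b ⊆ F := (Finset.subset_insert _ _).trans hEF
  by_cases hbF : b ∈ F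
  · refine h2 F hF fun x hx => ?_
    by_cases hxb : x = b
    · rwa [hxb]
    · exact hsub (Finset.mem_erase.2 ⟨hxb, hx⟩)
  · have h3 : insert b (F.erase a) ∈ 𝒜 := by
      refine h2 _ (by rw [card_insert_erase haF hbF, hF]) fun x hx => ?_
      by_cases hxb : x = b
      · simp [hxb]
      · refine Finset.mem_insert_of_mem (Finset.mem_erase.2 ⟨?_, hsub (Finset.mem_erase.2 ⟨hxb, hx⟩)⟩)
        rintro rfl; exact ha hx
    have := h a b hab _ h3 (Finset.mem_insert_self _ _) (by simp [hab.ne])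
    rwa [insert_erase_insert_erase haF hbF] at this

/-- Two generators extend to `k`-sets without creating new common points: `E` avoiding `D` first,
then `D` avoiding the extension of `E`. The condition `2 * k ≤ n` provides the room. -/
theorem gen_cross {n k t : ℕ} {𝒜 ℬ : Finset (Finset (Fin n))} (hn : 2 * k ≤ n)
    (h : CrossTIntersecting t 𝒜 ℬ) : CrossTIntersecting t (gen k 𝒜) (gen k ℬ) := by
  intro E hE D hD
  obtain ⟨hE1, hE2⟩ := mem_gen.1 hE
  obtain ⟨hD1, hD2⟩ := mem_gen.1 hD
  have h1 := Finset.card_union_le E D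
  obtain ⟨F, hF1, hF2, hF3⟩ := exists_extension (D := D) hE1 (by omega)
  have h2 := Finset.card_union_le D F
  obtain ⟨G, hG1, hG2, hG3⟩ := exists_extension (D := F) hD1 (by omega)
  have h3 := h F (hE2 F hF2 hF1) G (hD2 G hG2 hG1)
  rwa [Finset.inter_comm, hG3, Finset.inter_comm, hF3] at h3

/-! ### Pivots and trading -/

/-- The generators of size `i` inside `Iic p`. -/
def level {n : ℕ} (k : ℕ) (𝒜 : Finset (Finset (Fin n))) (p : Fin n) (i : ℕ) :
    Finset (Finset (Fin n)) :=
  (gen k 𝒜).filter fun E => E ⊆ Finset.Iic p ∧ E.card = i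

/-- The generators of size `i` inside `Iic p` which stop being generators without `p`. -/
def pivot {n : ℕ} (k : ℕ) (𝒜 : Finset (Finset (Fin n))) (p : Fin n) (i : ℕ) :
    Finset (Finset (Fin n)) :=
  (level k 𝒜 p i).filter fun E => p ∈ E ∧ E.erase p ∉ gen k 𝒜

/-- The `k`-sets whose trace on `S` belongs to `𝒢`. -/
def withTrace {n : ℕ} (k : ℕ) (S : Finset (Fin n)) (𝒢 : Finset (Finset (Fin n))) :
    Finset (Finset (Fin n)) :=
  (kSubsets n k).filter fun F => F ∩ S ∈ 𝒢

/-- Every member of `𝒜` has a generator as its trace on `Iic p`. -/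
def Determined {n : ℕ} (k : ℕ) (𝒜 : Finset (Finset (Fin n))) (p : Fin n) : Prop :=
  ∀ F ∈ 𝒜, F ∩ Finset.Iic p ∈ gen k 𝒜

theorem mem_level {n k : ℕ} {𝒜 : Finset (Finset (Fin n))} {p : Fin n} {i : ℕ}
    {E : Finset (Fin n)} :
    E ∈ level k 𝒜 p i ↔ E ∈ gen k 𝒜 ∧ E ⊆ Finset.Iic p ∧ E.card = i := by
  simp [level]

theorem mem_pivot {n k : ℕ} {𝒜 : Finset (Finset (Fin n))} {p : Fin n} {i : ℕ}
    {E : Finset (Fin n)} :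
    E ∈ pivot k 𝒜 p i ↔ (E ∈ gen k 𝒜 ∧ E ⊆ Finset.Iic p ∧ E.card = i) ∧ p ∈ E ∧
      E.erase p ∉ gen k 𝒜 := by
  simp [pivot, mem_level]

theorem mem_withTrace {n k : ℕ} {S F : Finset (Fin n)} {𝒢 : Finset (Finset (Fin n))} :
    F ∈ withTrace k S 𝒢 ↔ F.card = k ∧ F ∩ S ∈ 𝒢 := by
  simp [withTrace, mem_kSubsets]

theorem card_withTrace {n k i : ℕ} {S : Finset (Fin n)} {𝒢 : Finset (Finset (Fin n))}
    (hi : i ≤ k) (h : ∀ E ∈ 𝒢, E ⊆ S ∧ E.card = i) :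
    (withTrace k S 𝒢).card = 𝒢.card * (n - S.card).choose (k - i) := by
  have h1 : (𝒢 ×ˢ Finset.powersetCard (k - i) Sᶜ).card =
      𝒢.card * (n - S.card).choose (k - i) := by
    rw [Finset.card_product, Finset.card_powersetCard, Finset.card_compl, Fintype.card_fin]
  rw [← h1]
  refine Finset.card_nbij' (fun F => (F ∩ S, F \ S)) (fun x => x.1 ∪ x.2) ?_ ?_ ?_ ?_
  · intro F hF
    obtain ⟨h2, h3⟩ := mem_withTrace.1 hF
    have h4 := (h _ h3).2
    have h5 := Finset.card_sdiff_add_card_inter F S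
    simp only [Finset.coe_product, Set.mem_prod, Finset.mem_coe, Finset.mem_powersetCard]
    refine ⟨h3, fun x hx => ?_, by omega⟩
    simpa using (Finset.mem_sdiff.1 hx).2
  · rintro ⟨E, U⟩ hx
    simp only [Finset.coe_product, Set.mem_prod, Finset.mem_coe, Finset.mem_powersetCard] at hx
    obtain ⟨hE, hU, hc⟩ := hx
    have hd : ∀ x ∈ U, x ∉ S := fun x hx => by simpa using hU hx
    have h2 := h E hE
    refine mem_withTrace.2 ⟨?_, ?_⟩
    · rw [Finset.card_union_of_disjoint
        (Finset.disjoint_left.2 fun x hx hx' => hd x hx' (h2.1 hx)), h2.2, hc]; omega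
    · convert hE using 1
      ext x; simp only [Finset.mem_inter, Finset.mem_union]
      have := hd x; have := @h2.1 x; tauto
  · intro F _
    ext x; simp only [Finset.mem_union, Finset.mem_inter, Finset.mem_sdiff]; tauto
  · rintro ⟨E, U⟩ hx
    simp only [Finset.coe_product, Set.mem_prod, Finset.mem_coe, Finset.mem_powersetCard] at hx
    obtain ⟨hE, hU, hc⟩ := hx
    have hd : ∀ x ∈ U, x ∉ S := fun x hx => by simpa using hU hx
    have h2 := h E hE
    refine Prod.ext ?_ ?_
    · ext x; simp only [Finset.mem_inter, Finset.mem_union]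
      have := hd x; have := @h2.1 x; tauto
    · ext x; simp only [Finset.mem_sdiff, Finset.mem_union]
      have := hd x; have := @h2.1 x; tauto

theorem card_le_of_pivot {n k i : ℕ} {𝒜 : Finset (Finset (Fin n))} {p : Fin n}
    (h : (pivot k 𝒜 p i).Nonempty) : 1 ≤ i ∧ i ≤ k ∧ i ≤ p.val + 1 := by
  obtain ⟨E, hE⟩ := h
  obtain ⟨⟨h1, h2, h3⟩, h4, -⟩ := mem_pivot.1 hE
  refine ⟨?_, ?_, ?_⟩
  · rw [← h3]; exact Finset.card_pos.2 ⟨p, h4⟩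
  · rw [← h3]; exact (mem_gen.1 h1).1
  · rw [← h3]; exact (Finset.card_le_card h2).trans (Fin.card_Iic p).le

/-- The `k`-sets whose trace on `Iic p` is a pivot of size `i`. -/
def lower {n : ℕ} (k : ℕ) (𝒜 : Finset (Finset (Fin n))) (p : Fin n) (i : ℕ) :
    Finset (Finset (Fin n)) := withTrace k (Finset.Iic p) (pivot k 𝒜 p i)

/-- The `k`-sets whose trace on `Iic p` is a pivot of size `i` with `p` removed. -/
def upper {n : ℕ} (k : ℕ) (𝒜 : Finset (Finset (Fin n))) (p : Fin n) (i : ℕ) :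
    Finset (Finset (Fin n)) :=
  withTrace k (Finset.Iic p) ((pivot k 𝒜 p i).image fun E => E.erase p)

theorem card_lower {n k i : ℕ} (𝒜 : Finset (Finset (Fin n))) (p : Fin n) (hi : i ≤ k) :
    (lower k 𝒜 p i).card = (pivot k 𝒜 p i).card * (n - (p.val + 1)).choose (k - i) := by
  rw [lower, card_withTrace hi, Fin.card_Iic]
  exact fun E hE => (mem_pivot.1 hE).1.2

theorem card_upper {n k i : ℕ} (𝒜 : Finset (Finset (Fin n))) (p : Fin n) (hi : i ≤ k)
    (hi0 : 1 ≤ i) :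
    (upper k 𝒜 p i).card = (pivot k 𝒜 p i).card * (n - (p.val + 1)).choose (k - i + 1) := by
  rw [upper, card_withTrace (i := i - 1) (by omega), Fin.card_Iic, Finset.card_image_of_injOn]
  · congr 2; omega
  · intro E hE D hD h
    have h1 := (mem_pivot.1 hE).2.1
    have h2 := (mem_pivot.1 hD).2.1
    rw [← Finset.insert_erase h1, ← Finset.insert_erase h2]
    exact congrArg _ h
  · intro E hE
    obtain ⟨D, hD, rfl⟩ := Finset.mem_image.1 hE
    obtain ⟨⟨h1, h2, h3⟩, h4, -⟩ := mem_pivot.1 hD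
    exact ⟨(Finset.erase_subset _ _).trans h2, by rw [Finset.card_erase_of_mem h4, h3]⟩

/-- The sizes of `upper` and `lower` are proportional. -/
theorem card_upper_mul {n k i : ℕ} {𝒜 : Finset (Finset (Fin n))} {p : Fin n}
    (hi : i ≤ k) (hi0 : 1 ≤ i) (hp : p.val + 1 + k ≤ n + i) :
    (upper k 𝒜 p i).card * (k - i + 1) = (lower k 𝒜 p i).card * (n + i - (p.val + 1) - k) := by
  rw [card_upper 𝒜 p hi hi0, card_lower 𝒜 p hi, mul_assoc, mul_assoc,
    Nat.choose_succ_right_eq]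
  congr 2
  have := p.isLt
  omega

theorem lower_subset {n k i : ℕ} {𝒜 : Finset (Finset (Fin n))} {p : Fin n} :
    lower k 𝒜 p i ⊆ 𝒜 := by
  intro F hF
  obtain ⟨h1, h2⟩ := mem_withTrace.1 hF
  exact (mem_gen.1 (mem_pivot.1 h2).1.1).2 F h1 Finset.inter_subset_left

theorem disjoint_upper {n k i : ℕ} {𝒜 : Finset (Finset (Fin n))} {p : Fin n}
    (hd : Determined k 𝒜 p) : Disjoint 𝒜 (upper k 𝒜 p i) := by
  refine Finset.disjoint_left.2 fun F hF hF' => ?_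
  obtain ⟨E, hE, h⟩ := Finset.mem_image.1 (mem_withTrace.1 hF').2
  exact (mem_pivot.1 hE).2.2 (h ▸ hd F hF)

/-- A pivot without `p` is the trace of some `k`-set. -/
theorem upper_nonempty {n k i : ℕ} {𝒜 : Finset (Finset (Fin n))} {p : Fin n}
    (hs : Shifted 𝒜) (h : (pivot k 𝒜 p i).Nonempty) : (upper k 𝒜 p i).Nonempty := by
  obtain ⟨E, hE⟩ := h
  obtain ⟨⟨h1, h2, h3⟩, h4, h5⟩ := mem_pivot.1 hE
  have hc : (E.erase p).card ≤ k := (Finset.card_erase_le).trans (mem_gen.1 h1).1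
  rw [mem_gen, not_and] at h5
  have h6 := h5 hc
  push Not at h6
  obtain ⟨F, hF1, hF2, hF3⟩ := h6
  refine ⟨F, mem_withTrace.2 ⟨hF1, Finset.mem_image.2 ⟨E, hE, ?_⟩⟩⟩
  refine Finset.Subset.antisymm ?_ ?_
  · exact Finset.subset_inter hF2 ((Finset.erase_subset _ _).trans h2)
  -- An extra point `m` of `F` in `Iic p` would put a generator inside `F`: `E` itself if `m = p`,
  -- and `E` with `p` shifted to `m` otherwise. Then `F ∈ 𝒜`, against its choice.
  · intro m hm
    obtain ⟨hmF, hmp⟩ := Finset.mem_inter.1 hm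
    by_contra hmE
    apply hF3
    by_cases hmp' : m = p
    · refine (mem_gen.1 h1).2 F hF1 fun x hx => ?_
      by_cases hxp : x = p
      · rw [hxp, ← hmp']; exact hmF
      · exact hF2 (Finset.mem_erase.2 ⟨hxp, hx⟩)
    · have hmE' : m ∉ E := fun h => hmE (Finset.mem_erase.2 ⟨hmp', h⟩)
      have h7 := gen_shifted hs m p (lt_of_le_of_ne (Finset.mem_Iic.1 hmp) hmp') E h1 h4 hmE'
      refine (mem_gen.1 h7).2 F hF1 (Finset.insert_subset hmF hF2)

/-- Trading pivots of size `i` against those of the complementary size `j` preserves the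
cross-`t`-intersecting property. -/
theorem cross_trade {n k t i j : ℕ} {𝒜 ℬ : Finset (Finset (Fin n))} {p : Fin n}
    (hn : 2 * k ≤ n) (hℬ : ℬ ⊆ kSubsets n k) (hs : Shifted 𝒜)
    (hc : CrossTIntersecting t 𝒜 ℬ)
    (hd : Determined k ℬ p) (hij : i + j = p.val + 1 + t) :
    CrossTIntersecting t (𝒜 ∪ upper k 𝒜 p i) (ℬ \ lower k ℬ p j) := by
  have hg := gen_cross (k := k) hn hc
  intro F hF G hG
  obtain ⟨hG1, hG2⟩ := Finset.mem_sdiff.1 hG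
  rcases Finset.mem_union.1 hF with hF | hF
  · exact hc F hF G hG1
  obtain ⟨hFk, hF'⟩ := mem_withTrace.1 hF
  obtain ⟨E, hE, hEF⟩ := Finset.mem_image.1 hF'
  obtain ⟨⟨h1, h2, h3⟩, h4, h5⟩ := mem_pivot.1 hE
  have hD := hd G hG1
  set D := G ∩ Finset.Iic p with hDdef
  suffices h : t ≤ ((E.erase p) ∩ D).card by
    refine h.trans (Finset.card_le_card ?_)
    rw [hEF, hDdef]
    exact Finset.inter_subset_inter Finset.inter_subset_left Finset.inter_subset_left
  have hED := hg E h1 D hD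
  by_cases hpD : p ∈ D
  swap
  · convert hED using 2
    ext x; simp only [Finset.mem_inter, Finset.mem_erase]
    have : x ∈ D → x ≠ p := fun hx e => hpD (e ▸ hx)
    tauto
  by_cases hD' : D.erase p ∈ gen k ℬ
  · have := hg E h1 _ hD'
    convert this using 2
    ext x; simp only [Finset.mem_inter, Finset.mem_erase]; tauto
  have h6 : ((E.erase p) ∩ D).card + 1 = (E ∩ D).card := by
    rw [Finset.erase_inter, Finset.card_erase_add_one (Finset.mem_inter.2 ⟨h4, hpD⟩)]
  by_contra hlt
  have hcard : (E ∩ D).card = t := by omega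
  have hDp : D ⊆ Finset.Iic p := Finset.inter_subset_right
  -- A point of `Iic p` outside `E ∪ D` could replace `p` in `E`, giving a generator that meets `D`
  -- in only `t - 1` points. Hence the sizes of `E` and `D` add up to `p + 1 + t`, and `D` is one of
  -- the pivots given up.
  have hunion : E ∪ D = Finset.Iic p := by
    refine Finset.Subset.antisymm (Finset.union_subset h2 hDp) fun m hm => ?_
    by_contra hmED
    rw [Finset.mem_union, not_or] at hmED
    have hmp : m ≠ p := fun e => hmED.1 (e ▸ h4)
    have h7 := gen_shifted hs m p (lt_of_le_of_ne (Finset.mem_Iic.1 hm) hmp) E h1 h4 hmED.1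
    have h8 := hg _ h7 D hD
    rw [Finset.insert_inter_of_notMem hmED.2] at h8
    omega
  have h9 := Finset.card_union_add_card_inter E D
  rw [hunion, Fin.card_Iic, hcard, h3] at h9
  apply hG2
  have hDj : D.card = j := by omega
  exact mem_withTrace.2 ⟨mem_kSubsets.1 (hℬ hG1), mem_pivot.2 ⟨⟨hD, hDp, hDj⟩, hpD, hD'⟩⟩

theorem MaxCrossPair.trade {n k t i j : ℕ} {𝒜 ℬ : Finset (Finset (Fin n))} {p : Fin n}
    (hmax : MaxCrossPair k t 𝒜 ℬ)
    (hn : 2 * k ≤ n) (hs : Shifted 𝒜) (hdA : Determined k 𝒜 p)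
    (hd : Determined k ℬ p) (hij : i + j = p.val + 1 + t) :
    (𝒜.card + (upper k 𝒜 p i).card) * (ℬ.card - (lower k ℬ p j).card) ≤
      𝒜.card * ℬ.card := by
  have h1 := hmax.max (𝒜 ∪ upper k 𝒜 p i) (ℬ \ lower k ℬ p j)
    (Finset.union_subset hmax.left (Finset.filter_subset _ _))
    (Finset.sdiff_subset.trans hmax.right) (cross_trade hn hmax.right hs hmax.cross hd hij)
  rwa [Finset.card_union_of_disjoint (disjoint_upper hdA),
    Finset.card_sdiff_of_subset lower_subset] at h1

/-! ### Counting pivots and generators -/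

/-- A bound on the number of pivots through the sets obtained by moving `p`. -/
theorem card_pivot_mul_le {n k i : ℕ} {𝒜 : Finset (Finset (Fin n))} (hs : Shifted 𝒜)
    (p : Fin n) :
    (pivot k 𝒜 p i).card * (p.val + 1) ≤ i * (level k 𝒜 p i).card := by
  obtain ⟨T, hT⟩ : ∃ T, T = (level k 𝒜 p i).filter fun G => p ∉ G := ⟨_, rfl⟩
  -- Double counting: a pivot yields `p + 1 - i` generators without `p` by moving `p` to a free
  -- place, and each of these arises from at most `i` pivots.
  have h1 : (pivot k 𝒜 p i).card * (p.val + 1 - i) ≤ T.card * i := by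
    refine Finset.card_mul_le_card_mul
      (fun E G => ∃ m ∈ Finset.Iic p \ E, G = insert m (E.erase p)) ?_ ?_
    · intro E hE
      obtain ⟨⟨h1, h2, h3⟩, h4, h5⟩ := mem_pivot.1 hE
      have h6 : (Finset.Iic p \ E).card = p.val + 1 - i := by
        rw [Finset.card_sdiff_of_subset h2, Fin.card_Iic, h3]
      rw [← h6]
      refine Finset.card_le_card_of_injOn (fun m => insert m (E.erase p)) ?_ ?_
      · intro m hm
        obtain ⟨h7, h8⟩ := Finset.mem_sdiff.1 (Finset.mem_coe.1 hm)
        have hmp : m ≠ p := fun e => h8 (e ▸ h4)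
        rw [Finset.mem_coe, Finset.mem_bipartiteAbove, hT, Finset.mem_filter, mem_level]
        refine ⟨⟨⟨gen_shifted hs m p (lt_of_le_of_ne (Finset.mem_Iic.1 h7) hmp) E h1 h4 h8,
          Finset.insert_subset h7 ((Finset.erase_subset _ _).trans h2), ?_⟩, ?_⟩, m, ?_, rfl⟩
        · rw [card_insert_erase h4 h8, h3]
        · simp [hmp.symm]
        · exact Finset.mem_coe.1 hm
      · intro m hm m' hm' h
        obtain ⟨h7, h8⟩ := Finset.mem_sdiff.1 (Finset.mem_coe.1 hm)
        have h9 : m ∈ insert m' (E.erase p) := by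
          rw [← show insert m (E.erase p) = insert m' (E.erase p) from h]
          exact Finset.mem_insert_self _ _
        rcases Finset.mem_insert.1 h9 with h9 | h9
        · exact h9
        · exact absurd (Finset.mem_of_mem_erase h9) h8
    · intro G hG
      rw [hT] at hG
      have hGi : G.card = i := (mem_level.1 (Finset.mem_filter.1 hG).1).2.2
      refine (Finset.card_le_card (t := G.image fun m => insert p (G.erase m)) ?_).trans
        (Finset.card_image_le.trans hGi.le)
      intro E hE
      obtain ⟨hE, m, hm, hGE⟩ := (Finset.mem_bipartiteBelow _).1 hE
      have hpE : p ∈ E := (mem_pivot.1 hE).2.1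
      have hmE : m ∉ E := (Finset.mem_sdiff.1 hm).2
      refine Finset.mem_image.2 ⟨m, ?_, ?_⟩
      · rw [hGE]; exact Finset.mem_insert_self _ _
      · rw [hGE]; exact insert_erase_insert_erase hpE hmE
  have h2 : T.card + (pivot k 𝒜 p i).card ≤ (level k 𝒜 p i).card := by
    rw [← Finset.card_union_of_disjoint]
    · rw [hT]
      exact Finset.card_le_card (Finset.union_subset (Finset.filter_subset _ _)
        (Finset.filter_subset _ _))
    · rw [hT]
      exact Finset.disjoint_left.2 fun G h1 h2 =>
        (Finset.mem_filter.1 h1).2 (mem_pivot.1 h2).2.1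
  rcases Nat.lt_or_ge (p.val + 1) i with h3 | h3
  · have : pivot k 𝒜 p i = ∅ := by
      by_contra h4
      have := card_le_of_pivot (Finset.nonempty_iff_ne_empty.2 h4)
      omega
    simp [this]
  · obtain ⟨d, hd⟩ := Nat.exists_eq_add_of_le h3
    rw [hd] at h1 ⊢
    rw [Nat.add_sub_cancel_left] at h1
    nlinarith

/-- The upper shadow bound for consecutive levels of generators. -/
theorem card_level_mul_le {n k i : ℕ} {𝒜 : Finset (Finset (Fin n))} (hi : i + 1 ≤ k)
    (p : Fin n) :
    (level k 𝒜 p i).card * (p.val + 1 - i) ≤ (level k 𝒜 p (i + 1)).card * (i + 1) := by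
  refine Finset.card_mul_le_card_mul (fun E G => ∃ m ∈ Finset.Iic p \ E, G = insert m E) ?_ ?_
  · intro E hE
    obtain ⟨h1, h2, h3⟩ := mem_level.1 hE
    have h6 : (Finset.Iic p \ E).card = p.val + 1 - i := by
      rw [Finset.card_sdiff_of_subset h2, Fin.card_Iic, h3]
    rw [← h6]
    refine Finset.card_le_card_of_injOn (fun m => insert m E) ?_ ?_
    · intro m hm
      obtain ⟨h7, h8⟩ := Finset.mem_sdiff.1 (Finset.mem_coe.1 hm)
      have hc : (insert m E).card = i + 1 := by rw [Finset.card_insert_of_notMem h8, h3]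
      rw [Finset.mem_coe, Finset.mem_bipartiteAbove, mem_level]
      exact ⟨⟨gen_mono h1 (Finset.subset_insert _ _) (hc.le.trans hi),
        Finset.insert_subset h7 h2, hc⟩,
        m, Finset.mem_coe.1 hm, rfl⟩
    · intro m hm m' hm' h
      obtain ⟨h7, h8⟩ := Finset.mem_sdiff.1 (Finset.mem_coe.1 hm)
      have h9 : m ∈ insert m' E := by
        rw [← show insert m E = insert m' E from h]
        exact Finset.mem_insert_self _ _
      exact (Finset.mem_insert.1 h9).resolve_right h8
  · intro G hG
    have hGi : G.card = i + 1 := (mem_level.1 hG).2.2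
    calc _ ≤ (G.image fun m => G.erase m).card := by
          refine Finset.card_le_card fun E hE => ?_
          obtain ⟨hE, m, hm, rfl⟩ := (Finset.mem_bipartiteBelow _).1 hE
          refine Finset.mem_image.2 ⟨m, Finset.mem_insert_self _ _, ?_⟩
          exact Finset.erase_insert (Finset.mem_sdiff.1 hm).2
      _ ≤ i + 1 := Finset.card_image_le.trans hGi.le

theorem withTrace_level_subset {n k i : ℕ} {𝒜 : Finset (Finset (Fin n))} {p : Fin n} :
    withTrace k (Finset.Iic p) (level k 𝒜 p i) ⊆ 𝒜 := by
  intro F hF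
  obtain ⟨h1, h2⟩ := mem_withTrace.1 hF
  exact (mem_gen.1 (mem_level.1 h2).1).2 F h1 Finset.inter_subset_left

theorem card_level_le {n k i : ℕ} (𝒜 : Finset (Finset (Fin n))) (p : Fin n) (hi : i ≤ k) :
    (level k 𝒜 p i).card * (n - (p.val + 1)).choose (k - i) ≤ 𝒜.card := by
  have h := Finset.card_le_card (withTrace_level_subset (k := k) (i := i) (𝒜 := 𝒜) (p := p))
  rwa [card_withTrace hi (fun E hE => (mem_level.1 hE).2), Fin.card_Iic] at h

/-- Traces of different sizes come from different sets, so the two contributions to `𝒜` are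
disjoint. -/
theorem card_level_add_le {n k i : ℕ} (𝒜 : Finset (Finset (Fin n))) (p : Fin n)
    (hi : i + 1 ≤ k) :
    (level k 𝒜 p i).card * (n - (p.val + 1)).choose (k - i) +
      (level k 𝒜 p (i + 1)).card * (n - (p.val + 1)).choose (k - (i + 1)) ≤ 𝒜.card := by
  have h1 := withTrace_level_subset (k := k) (i := i) (𝒜 := 𝒜) (p := p)
  have h2 := withTrace_level_subset (k := k) (i := i + 1) (𝒜 := 𝒜) (p := p)
  have h := Finset.card_le_card (Finset.union_subset h1 h2)
  rw [Finset.card_union_of_disjoint] at h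
  · rwa [card_withTrace (i := i) (by omega) (fun E hE => (mem_level.1 hE).2),
      card_withTrace hi (fun E hE => (mem_level.1 hE).2), Fin.card_Iic] at h
  · refine Finset.disjoint_left.2 fun F h3 h4 => ?_
    have := (mem_level.1 (mem_withTrace.1 h3).2).2.2
    have := (mem_level.1 (mem_withTrace.1 h4).2).2.2
    omega

/-- Pivots form at most a fraction `i / (p + 1)` of their level, and every `k`-set with trace in
that level belongs to `𝒜`. -/
theorem card_lower_mul_le {n k i : ℕ} {𝒜 : Finset (Finset (Fin n))} (hs : Shifted 𝒜)
    (p : Fin n) (hi : i ≤ k) :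
    (lower k 𝒜 p i).card * (p.val + 1) ≤ i * 𝒜.card := by
  have h1 := card_pivot_mul_le (k := k) (i := i) hs p
  have h2 := card_level_le 𝒜 p hi
  rw [card_lower 𝒜 p hi]
  calc _ = (pivot k 𝒜 p i).card * (p.val + 1) * (n - (p.val + 1)).choose (k - i) := by ring
    _ ≤ i * (level k 𝒜 p i).card * (n - (p.val + 1)).choose (k - i) := Nat.mul_le_mul_right _ h1
    _ = i * ((level k 𝒜 p i).card * (n - (p.val + 1)).choose (k - i)) := by ring
    _ ≤ _ := Nat.mul_le_mul_left _ h2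

/-! ### Numerical consequences of the trades -/

/-- Here `a`, `b` are the family sizes, `X`, `Y` the numbers of sets given up and `X'`, `Y'` the
numbers gained. The trade `h₁` bounds `Y` from below and `h₂` bounds it from above; eliminating `Y`
and `b` leaves a condition on `X / a` alone. -/
theorem trade_inequality {a b X Y X' Y' p₁ q₁ p₂ q₂ : ℝ} (hb : 0 < b) (hX : 0 < X)
    (hXa : X ≤ a) (hp₂ : 0 ≤ p₂) (hq₁ : 0 < q₁) (hq₂ : 0 < q₂)
    (e₁ : X' * q₁ = X * p₁) (e₂ : Y' * q₂ = Y * p₂)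
    (h₁ : (a + X') * (b - Y) ≤ a * b) (h₂ : (b + Y') * (a - X) ≤ b * a)
    (hpos : 0 ≤ a * q₁ + X * p₁) :
    p₁ * p₂ * (a - X) ≤ q₂ * (a * q₁ + X * p₁) := by
  have i₁ : b * (X * p₁) ≤ Y * (a * q₁ + X * p₁) := by
    have : (a * q₁ + X * p₁) * (b - Y) ≤ a * b * q₁ := by
      rw [← e₁]; nlinarith
    nlinarith
  have i₂ : Y * p₂ * (a - X) ≤ X * b * q₂ := by
    have : (b * q₂ + Y * p₂) * (a - X) ≤ b * a * q₂ := by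
      rw [← e₂]; nlinarith
    nlinarith
  have i₃ := mul_le_mul_of_nonneg_right i₁ (mul_nonneg hp₂ (sub_nonneg.2 hXa))
  have i₄ := mul_le_mul_of_nonneg_right i₂ hpos
  have i₅ : b * X * (p₁ * p₂ * (a - X)) ≤ b * X * (q₂ * (a * q₁ + X * p₁)) := by
    calc _ = b * (X * p₁) * (p₂ * (a - X)) := by ring
      _ ≤ Y * (a * q₁ + X * p₁) * (p₂ * (a - X)) := i₃
      _ = Y * p₂ * (a - X) * (a * q₁ + X * p₁) := by ring
      _ ≤ X * b * q₂ * (a * q₁ + X * p₁) := i₄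
      _ = _ := by ring
  exact le_of_mul_le_mul_left i₅ (mul_pos hb hX)

/-- In the extremal case `p₁ = t * q₂`, `p₂ = t * q₁`, the hypothesis together with `q₂ ≤ q₁` gives
`t² (a - X) ≤ a + t X`, which is the claim multiplied by `t + 1`. -/
theorem proportion_bound {a X p₁ q₁ p₂ q₂ t : ℝ} (ha : 0 < a) (hX : 0 < X) (ht : 1 ≤ t)
    (hq₂ : 0 < q₂) (hq : q₂ ≤ q₁) (h₁ : t * q₂ ≤ p₁) (h₂ : t * q₁ ≤ p₂)
    (h : p₁ * p₂ * (a - X) ≤ q₂ * (a * q₁ + X * p₁)) :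
    (t - 1) * a ≤ t * X ∧ (t * q₂ < p₁ → (t - 1) * a < t * X) := by
  have hq₁ : 0 < q₁ := hq₂.trans_le hq
  have hp₁ : 0 < p₁ := lt_of_lt_of_le (by positivity) h₁
  have hp₂ : 0 < p₂ := lt_of_lt_of_le (by positivity) h₂
  have hP : 0 < p₁ * p₂ := mul_pos hp₁ hp₂
  have s₁ : t * (p₁ * q₂) ≤ p₁ * p₂ := by
    calc t * (p₁ * q₂) = p₁ * (t * q₂) := by ring
      _ ≤ p₁ * p₂ := mul_le_mul_of_nonneg_left (by nlinarith) hp₁.le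
  have s₂ : X * (t * (p₁ * q₂)) ≤ X * (p₁ * p₂) := mul_le_mul_of_nonneg_left s₁ hX.le
  have s₃ : t ^ 2 * (q₁ * q₂) = (t * q₂) * (t * q₁) := by ring
  have s₄ : a * (p₁ * p₂ - q₁ * q₂) ≤ X * (p₁ * p₂ + p₁ * q₂) := by linarith
  have s₅ : t ^ 2 * (a * (p₁ * p₂ - q₁ * q₂)) ≤ t ^ 2 * (X * (p₁ * p₂ + p₁ * q₂)) :=
    mul_le_mul_of_nonneg_left s₄ (by positivity)
  have s₆ : t * (X * (t * (p₁ * q₂))) ≤ t * (X * (p₁ * p₂)) :=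
    mul_le_mul_of_nonneg_left s₂ (by linarith)
  constructor
  · have s₇ : (t * q₂) * (t * q₁) ≤ p₁ * p₂ := mul_le_mul h₁ h₂ (by positivity) hp₁.le
    have s₈ : a * ((t * q₂) * (t * q₁)) ≤ a * (p₁ * p₂) := mul_le_mul_of_nonneg_left s₇ ha.le
    have s₉ : (p₁ * p₂ * (t + 1)) * ((t - 1) * a) ≤ (p₁ * p₂ * (t + 1)) * (t * X) := by
      linarith
    exact le_of_mul_le_mul_left s₉ (by positivity)
  · intro h₁'
    have s₇ : (t * q₂) * (t * q₁) < p₁ * p₂ := mul_lt_mul h₁' h₂ (by positivity) hp₁.le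
    have s₈ : a * ((t * q₂) * (t * q₁)) < a * (p₁ * p₂) := mul_lt_mul_of_pos_left s₇ ha
    have s₉ : (p₁ * p₂ * (t + 1)) * ((t - 1) * a) < (p₁ * p₂ * (t + 1)) * (t * X) := by
      linarith
    exact lt_of_mul_lt_mul_left s₉ (by positivity)

/-- The possible sizes of pivots in a maximum pair. -/
theorem pivot_sizes {t s i j : ℕ} (ht : 3 ≤ t) (hi : t + 1 ≤ i) (hij : i ≤ j)
    (h : i + j = s + t) (hs : t + 2 ≤ j → (t - 1) * s < t * i) :
    (i = t + 1 ∧ j = t + 1) ∨ (t = 3 ∧ s = 7 ∧ i = 5) := by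
  rcases Nat.lt_or_ge j (t + 2) with h1 | h1
  · left; omega
  right
  have h2 := hs h1
  obtain ⟨u, rfl⟩ : ∃ u, t = u + 3 := ⟨t - 3, by omega⟩
  obtain ⟨d, rfl⟩ : ∃ d, i = u + 3 + 1 + d := ⟨i - (u + 3 + 1), by omega⟩
  obtain ⟨e, rfl⟩ : ∃ e, j = u + 3 + 1 + d + e := ⟨j - (u + 3 + 1 + d), by omega⟩
  have h3 : s = u + 5 + 2 * d + e := by omega
  subst h3
  rw [show u + 3 - 1 = u + 2 from rfl] at h2
  -- With `i = t + 1 + d` and `j = i + e`, the inequality `h2` says `(t - 2) d + (t - 1) e < 2`.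
  have hd : d ≤ 1 := by
    by_contra hd
    nlinarith [Nat.zero_le (u * e), Nat.zero_le (u * u), Nat.mul_le_mul_left u (show 2 ≤ d by omega)]
  interval_cases d
  · have : 1 ≤ e := by omega
    nlinarith
  · have : u = 0 := by nlinarith
    subst this
    omega

/-- Eliminating `X` gives `7 (x - k + 3)(3 x + k - 5) ≤ 15 x (x - 1)`. At `x = 3 k - 9` the left
side is larger by `(k - 3)(5 k + 2)`, and the difference grows with `x`. -/
theorem pair_inequality_false {a X x k : ℝ} (ha : 0 < a) (hk : 5 ≤ k)
    (hx : 3 * k - 9 ≤ x) (h₁ : a * (x - k + 3) ≤ X * (x - 1))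
    (h₂ : 7 * X * (3 * x + k - 5) ≤ 15 * a * x) : False := by
  have h₃ := mul_le_mul_of_nonneg_right h₁ (show 0 ≤ 3 * x + k - 5 by linarith)
  have h₄ := mul_le_mul_of_nonneg_right h₂ (show 0 ≤ x - 1 by linarith)
  have h₅ : a * (7 * (x - k + 3) * (3 * x + k - 5)) ≤ a * (15 * x * (x - 1)) := by linarith
  have h₆ := le_of_mul_le_mul_left h₅ ha
  nlinarith [mul_nonneg (sub_nonneg.2 hx) (sub_nonneg.2 hk),
    mul_nonneg (sub_nonneg.2 hx) (sub_nonneg.2 hx), mul_nonneg (sub_nonneg.2 hk) (sub_nonneg.2 hk)]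

/-! ### Pivots of a shifted maximum pair -/

section MaxPair

variable {n k t : ℕ} {𝒜 ℬ : Finset (Finset (Fin n))} {p : Fin n}

/-- A shifted maximum pair, both of whose members are determined by their traces on `Iic p`. -/
structure ShiftedMaxPair {n : ℕ} (k t : ℕ) (𝒜 ℬ : Finset (Finset (Fin n))) (p : Fin n) :
    Prop where
  max : MaxCrossPair k t 𝒜 ℬ
  posLeft : 0 < 𝒜.card
  posRight : 0 < ℬ.card
  shiftedLeft : Shifted 𝒜
  shiftedRight : Shifted ℬ
  determinedLeft : Determined k 𝒜 p
  determinedRight : Determined k ℬ p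
  two_mul_le : 2 * k ≤ n

theorem ShiftedMaxPair.symm (h : ShiftedMaxPair k t 𝒜 ℬ p) : ShiftedMaxPair k t ℬ 𝒜 p :=
  ⟨h.max.symm, h.posRight, h.posLeft, h.shiftedRight, h.shiftedLeft, h.determinedRight,
    h.determinedLeft, h.two_mul_le⟩

theorem ShiftedMaxPair.cross_gen (h : ShiftedMaxPair k t 𝒜 ℬ p) :
    CrossTIntersecting t (gen k 𝒜) (gen k ℬ) := gen_cross h.two_mul_le h.max.cross

theorem ShiftedMaxPair.le_card_gen (h : ShiftedMaxPair k t 𝒜 ℬ p) {E : Finset (Fin n)}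
    (hE : E ∈ gen k 𝒜) : t ≤ E.card := by
  obtain ⟨G, hG⟩ := Finset.card_pos.1 h.posRight
  exact (h.cross_gen E hE _ (h.determinedRight G hG)).trans
    (Finset.card_le_card Finset.inter_subset_left)

theorem ShiftedMaxPair.trade (h : ShiftedMaxPair k t 𝒜 ℬ p) {i j : ℕ}
    (hij : i + j = p.val + 1 + t) :
    ((𝒜.card : ℝ) + (upper k 𝒜 p i).card) * (ℬ.card - (lower k ℬ p j).card) ≤
      𝒜.card * ℬ.card := by
  have h1 := h.max.trade h.two_mul_le h.shiftedLeft h.determinedLeft h.determinedRight hij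
  rw [← Nat.cast_sub (Finset.card_le_card lower_subset)]
  exact_mod_cast h1

/-- Without pivots of size `j` in `ℬ` the trade would enlarge `𝒜` at no cost. -/
theorem ShiftedMaxPair.exists_partner (h : ShiftedMaxPair k t 𝒜 ℬ p) {i j : ℕ}
    (hij : i + j = p.val + 1 + t) (hi : (pivot k 𝒜 p i).Nonempty) :
    (pivot k ℬ p j).Nonempty := by
  by_contra hj
  rw [Finset.not_nonempty_iff_eq_empty] at hj
  have h1 := h.max.trade h.two_mul_le h.shiftedLeft h.determinedLeft h.determinedRight hij
  have h2 : lower k ℬ p j = ∅ := by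
    rw [lower, hj]
    exact Finset.filter_eq_empty_iff.2 fun F _ => Finset.notMem_empty _
  rw [h2, Finset.card_empty, Nat.sub_zero] at h1
  have h3 := Finset.card_pos.2 (upper_nonempty h.shiftedLeft hi)
  have h4 := h.posRight
  nlinarith

/-- The relation `hij` eliminates `p`, which gives the ratios for the two families mirror-image
forms. -/
theorem ShiftedMaxPair.card_upper_mul (h : ShiftedMaxPair k t 𝒜 ℬ p) {i j : ℕ}
    (hij : i + j = p.val + 1 + t) (hi : (pivot k 𝒜 p i).Nonempty)
    (hj : (pivot k ℬ p j).Nonempty) :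
    ((upper k 𝒜 p i).card : ℝ) * (k - i + 1) = (lower k 𝒜 p i).card * (n + t - j - k) := by
  obtain ⟨i1, i2, i3⟩ := card_le_of_pivot hi
  obtain ⟨j1, j2, j3⟩ := card_le_of_pivot hj
  have h1 := h.two_mul_le
  have h2 := _root_.card_upper_mul (𝒜 := 𝒜) (p := p) (n := n) i2 i1 (by omega)
  have h3 : n + i - (p.val + 1) - k = n + t - j - k := by omega
  rw [h3] at h2
  have h4 : ((n + t - j - k : ℕ) : ℝ) = n + t - j - k := by
    rw [Nat.cast_sub (by omega), Nat.cast_sub (by omega)]; push_cast; ring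
  have h5 : ((k - i + 1 : ℕ) : ℝ) = k - i + 1 := by
    push_cast [Nat.cast_sub i2]; ring
  rw [← h4, ← h5]
  exact_mod_cast h2

theorem lower_pos {i : ℕ} (hs : Shifted 𝒜) (hi : (pivot k 𝒜 p i).Nonempty) :
    0 < (lower k 𝒜 p i).card := by
  obtain ⟨i1, i2, i3⟩ := card_le_of_pivot hi
  have h1 := Finset.card_pos.2 (upper_nonempty hs hi)
  rw [card_upper 𝒜 p i2 i1] at h1
  rw [card_lower 𝒜 p i2]
  have h2 := Nat.pos_of_mul_pos_left h1
  have h3 : k - i + 1 ≤ n - (p.val + 1) := by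
    by_contra h3
    rw [Nat.choose_eq_zero_of_lt (by omega)] at h2
    exact lt_irrefl _ h2
  exact Nat.mul_pos (Finset.card_pos.2 hi) (Nat.choose_pos (by omega))

theorem ShiftedMaxPair.lower_inequality (h : ShiftedMaxPair k t 𝒜 ℬ p) {i j : ℕ}
    (hij : i + j = p.val + 1 + t) (hi : (pivot k 𝒜 p i).Nonempty) :
    ((n : ℝ) + t - j - k) * (n + t - i - k) * (𝒜.card - (lower k 𝒜 p i).card) ≤
      (k - j + 1) * (𝒜.card * (k - i + 1) + (lower k 𝒜 p i).card * (n + t - j - k)) := by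
  have hj := h.exists_partner hij hi
  obtain ⟨i1, i2, i3⟩ := card_le_of_pivot hi
  obtain ⟨j1, j2, j3⟩ := card_le_of_pivot hj
  have h1 := h.two_mul_le
  have hji : j + i = p.val + 1 + t := by omega
  have c1 : (i : ℝ) ≤ k := by exact_mod_cast i2
  have c2 : (j : ℝ) ≤ k := by exact_mod_cast j2
  have c3 : (2 : ℝ) * k ≤ n := by exact_mod_cast h1
  have c4 : (0 : ℝ) ≤ t := Nat.cast_nonneg _
  refine trade_inequality (by exact_mod_cast h.posRight)
    (by exact_mod_cast lower_pos h.shiftedLeft hi)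
    (by exact_mod_cast Finset.card_le_card lower_subset) (by linarith) (by linarith) (by linarith)
    (h.card_upper_mul hij hi hj) (h.symm.card_upper_mul hji hj hi) (h.trade hij)
    (h.symm.trade hji) ?_
  have c5 : (0 : ℝ) ≤ k - i + 1 := by linarith
  have c6 : (0 : ℝ) ≤ n + t - j - k := by linarith
  positivity

theorem ShiftedMaxPair.proportion (h : ShiftedMaxPair k t 𝒜 ℬ p) {i j : ℕ} (ht : 3 ≤ t)
    (hn : (t + 1) * (k - t + 1) ≤ n)
    (hij : i + j = p.val + 1 + t) (hi : (pivot k 𝒜 p i).Nonempty) (hti : t + 1 ≤ i)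
    (hle : i ≤ j) :
    ((t : ℝ) - 1) * 𝒜.card ≤ t * (lower k 𝒜 p i).card ∧
      (t + 2 ≤ j → ((t : ℝ) - 1) * 𝒜.card < t * (lower k 𝒜 p i).card) := by
  have hj := h.exists_partner hij hi
  obtain ⟨i1, i2, i3⟩ := card_le_of_pivot hi
  obtain ⟨j1, j2, j3⟩ := card_le_of_pivot hj
  have c1 : (i : ℝ) ≤ k := by exact_mod_cast i2
  have c2 : (j : ℝ) ≤ k := by exact_mod_cast j2
  have c3 : ((t : ℝ) + 1) * (k - t + 1) ≤ n := by
    have h5 : ((k - t + 1 : ℕ) : ℝ) = k - t + 1 := by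
      push_cast [Nat.cast_sub (show t ≤ k by omega)]; ring
    rw [← h5]; exact_mod_cast hn
  have c4 : (3 : ℝ) ≤ t := by exact_mod_cast ht
  have c5 : (t : ℝ) + 1 ≤ i := by exact_mod_cast hti
  have c6 : (i : ℝ) ≤ j := by exact_mod_cast hle
  -- At the threshold value of `n`, the two comparisons with `t` reduce to `(t - 1)(j - t - 1) ≥ 0`
  -- and `(t - 1)(i - t - 1) ≥ 0`; the first is strict for `j ≥ t + 2`.
  obtain ⟨h1, h2⟩ := proportion_bound (by exact_mod_cast h.posLeft)
    (by exact_mod_cast lower_pos h.shiftedLeft hi)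
    (show (1 : ℝ) ≤ t by linarith) (by linarith) (by linarith) (by nlinarith) (by nlinarith)
    (h.lower_inequality hij hi)
  refine ⟨h1, fun h3 => h2 ?_⟩
  have c7 : (t : ℝ) + 2 ≤ j := by exact_mod_cast h3
  nlinarith

/-- There are no pivots of size `t` beyond the trivial case. -/
theorem ShiftedMaxPair.not_pivot_t (h : ShiftedMaxPair k t 𝒜 ℬ p)
    (hk : t ≤ k) (hn : (t + 1) * (k - t + 1) ≤ n) (hp : t < p.val + 1) :
    ¬ (pivot k 𝒜 p t).Nonempty := by
  intro hi
  have hij : t + (p.val + 1) = p.val + 1 + t := by omega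
  have hj := h.exists_partner hij hi
  obtain ⟨j1, j2, j3⟩ := card_le_of_pivot hj
  obtain ⟨E, hE⟩ := id hi
  obtain ⟨⟨h1, h2, h3⟩, h4, h5⟩ := mem_pivot.1 hE
  have sub : ∀ E' ∈ gen k 𝒜, E'.card = t → ∀ D ∈ gen k ℬ, E' ⊆ D := by
    intro E' hE' hc D hD
    have h6 := h.cross_gen E' hE' D hD
    have h7 : E' ∩ D = E' :=
      Finset.eq_of_subset_of_card_le Finset.inter_subset_left (by omega)
    exact Finset.inter_eq_left.1 h7
  -- A generator of size `t` lies in every generator of `ℬ`. So do its shifts, which together with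
  -- it cover `Iic p`; hence all of `ℬ` lies over the single pivot `Iic p`.
  have full : ∀ D ∈ gen k ℬ, Finset.Iic p ⊆ D := by
    intro D hD m hm
    by_cases hmE : m ∈ E
    · exact sub E h1 h3 D hD hmE
    · have hmp : m ≠ p := fun e => hmE (e ▸ h4)
      have h6 := gen_shifted h.shiftedLeft m p
        (lt_of_le_of_ne (Finset.mem_Iic.1 hm) hmp) E h1 h4 hmE
      exact sub _ h6 (by rw [card_insert_erase h4 hmE, h3]) D hD (Finset.mem_insert_self _ _)
  have hlow : lower k ℬ p (p.val + 1) = ℬ := by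
    refine Finset.Subset.antisymm lower_subset fun G hG => ?_
    have h6 := h.determinedRight G hG
    have h7 : G ∩ Finset.Iic p = Finset.Iic p :=
      Finset.Subset.antisymm Finset.inter_subset_right (full _ h6)
    rw [h7] at h6
    refine mem_withTrace.2 ⟨mem_kSubsets.1 (h.max.right hG), ?_⟩
    rw [h7]
    refine mem_pivot.2 ⟨⟨h6, subset_rfl, Fin.card_Iic p⟩, Finset.mem_Iic.2 le_rfl, fun h8 => ?_⟩
    exact Finset.notMem_erase p _ (full _ h8 (Finset.mem_Iic.2 le_rfl))
  have t1 := h.symm.trade (show (p.val + 1) + t = p.val + 1 + t from rfl)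
  have t2 := h.symm.card_upper_mul (show (p.val + 1) + t = p.val + 1 + t from rfl) hj hi
  rw [hlow] at t2
  have t3 := card_lower_mul_le h.shiftedLeft p hk
  have t4 : ((lower k 𝒜 p t).card : ℝ) * (p.val + 1) ≤ t * 𝒜.card := by exact_mod_cast t3
  have ha : (0 : ℝ) < 𝒜.card := by exact_mod_cast h.posLeft
  have hb : (0 : ℝ) < ℬ.card := by exact_mod_cast h.posRight
  have c3 : ((t : ℝ) + 1) * (k - t + 1) ≤ n := by
    have h5 : ((k - t + 1 : ℕ) : ℝ) = k - t + 1 := by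
      push_cast [Nat.cast_sub hk]; ring
    rw [← h5]; exact_mod_cast hn
  have c2 : ((p.val : ℝ) + 1) ≤ k := by exact_mod_cast j2
  have c4 : (t : ℝ) + 1 ≤ p.val + 1 := by exact_mod_cast hp
  have c0 : (0 : ℝ) ≤ t := Nat.cast_nonneg _
  push_cast at t2
  generalize ((upper k ℬ p (p.val + 1)).card : ℝ) = Y at *
  generalize ((lower k 𝒜 p t).card : ℝ) = X at *
  generalize (𝒜.card : ℝ) = a at *
  generalize (ℬ.card : ℝ) = b at *
  generalize (p.val : ℝ) = q at *
  have u1 : (b * (k - q) + b * (n - k)) * (a - X) ≤ b * a * (k - q) := by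
    have : (b * (k - q) + b * (n - k)) = (b + Y) * (k - q) := by linarith
    rw [this]
    have := mul_le_mul_of_nonneg_right t1 (show (0 : ℝ) ≤ k - q by linarith)
    linarith
  have u2 : (n - q) * (a - X) ≤ a * (k - q) := by
    refine le_of_mul_le_mul_left ?_ hb
    linarith
  have u3 : (q + 1 - t) * a ≤ (a - X) * (q + 1) := by linarith
  have hnq : (0 : ℝ) ≤ n - q := by nlinarith
  have u4 : (n - q) * ((q + 1 - t) * a) ≤ (a * (k - q)) * (q + 1) := by
    calc _ ≤ (n - q) * ((a - X) * (q + 1)) := mul_le_mul_of_nonneg_left u3 hnq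
      _ = (n - q) * (a - X) * (q + 1) := by ring
      _ ≤ _ := mul_le_mul_of_nonneg_right u2 (by linarith)
  have u5 : (n - q) * (q + 1 - t) ≤ (k - q) * (q + 1) := by
    refine le_of_mul_le_mul_left ?_ ha
    linarith
  -- Since `q ≥ t`, the difference in `u6` is at least `t (q - t) + 1` and the one in `u8` equals `t
  -- (q - t)`. Chained together they contradict `u5`.
  have u6 : (t + 1) * ((k : ℝ) - q) < n - q := by nlinarith
  have u7 : (t + 1) * ((k : ℝ) - q) * (q + 1 - t) < (n - q) * (q + 1 - t) :=
    mul_lt_mul_of_pos_right u6 (by linarith)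
  have u8 : q + 1 ≤ (t + 1) * (q + 1 - t) := by nlinarith
  have u9 := mul_le_mul_of_nonneg_left u8 (show (0 : ℝ) ≤ k - q by linarith)
  linarith

/-- The sporadic pivot size is ruled out by counting one further level. -/
theorem ShiftedMaxPair.not_pivot_five (h : ShiftedMaxPair k 3 𝒜 ℬ p)
    (hn : (3 + 1) * (k - 3 + 1) ≤ n) (hp : p.val + 1 = 7) : ¬ (pivot k 𝒜 p 5).Nonempty := by
  intro hi
  obtain ⟨-, i2, -⟩ := card_le_of_pivot hi
  have h1 := h.lower_inequality (show 5 + 5 = p.val + 1 + 3 by omega) hi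
  have hn' : (4 : ℝ) * (k - 2) ≤ n := by
    have : 4 * k ≤ n + 8 := by omega
    have : (4 : ℝ) * k ≤ n + 8 := by exact_mod_cast this
    linarith
  have hk' : (5 : ℝ) ≤ k := by exact_mod_cast i2
  have ha : (0 : ℝ) < 𝒜.card := by exact_mod_cast h.posLeft
  refine pair_inequality_false (a := 𝒜.card) (X := (lower k 𝒜 p 5).card) (x := n - k - 1) ha hk'
    (by linarith) ?_ ?_
  · push_cast at h1
    -- Here `i = j = 5`, and the difference of squares `(n - k - 2)² - (k - 4)²` has the factor `n -
    -- 6`, which cancels.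
    have h2 : ((n : ℝ) - 6) * (𝒜.card * (n - k - 1 - k + 3)) ≤
        (n - 6) * ((lower k 𝒜 p 5).card * (n - k - 1 - 1)) := by linarith
    exact le_of_mul_le_mul_left h2 (by linarith)
  · have l1 := card_pivot_mul_le (k := k) (i := 5) h.shiftedLeft p
    rw [hp] at l1
    have m1 : ((pivot k 𝒜 p 5).card : ℝ) * 7 ≤ 5 * (level k 𝒜 p 5).card := by exact_mod_cast l1
    rw [card_lower 𝒜 p i2, hp]
    -- The bound `5/7` from level 5 alone is compatible with the lower bound `2/3`. Level 6, which
    -- exists once `k ≥ 6`, contains at least a third as many generators as level 5 and sharpens it.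
    rcases Nat.lt_or_ge k 6 with h6 | h6
    · have hk5 : k = 5 := by omega
      subst hk5
      have l2 := card_level_le 𝒜 p i2
      rw [hp] at l2
      simp only [Nat.sub_self, Nat.choose_zero_right, mul_one] at l2 ⊢
      have m2 : ((level 5 𝒜 p 5).card : ℝ) ≤ 𝒜.card := by exact_mod_cast l2
      push_cast at hn' ⊢
      nlinarith
    · have l2 := card_level_add_le 𝒜 p h6
      have l3 := card_level_mul_le (𝒜 := 𝒜) h6 p
      rw [hp] at l2 l3
      have l4 := Nat.choose_succ_right_eq (n - 7) (k - 6)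
      rw [show k - 6 + 1 = k - 5 by omega, show n - 7 - (k - 6) = n - k - 1 by omega] at l4
      have m2 : ((level k 𝒜 p 5).card : ℝ) * ((n - 7).choose (k - 5) : ℕ) +
        (level k 𝒜 p 6).card * ((n - 7).choose (k - 6) : ℕ) ≤ 𝒜.card := by exact_mod_cast l2
      have m3 : ((level k 𝒜 p 5).card : ℝ) * 2 ≤ (level k 𝒜 p 6).card * 6 := by exact_mod_cast l3
      have m4 : (((n - 7).choose (k - 5) : ℕ) : ℝ) * (k - 5) =
          ((n - 7).choose (k - 6) : ℕ) * (n - k - 1) := by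
        have e1 : ((k - 5 : ℕ) : ℝ) = k - 5 := by push_cast [Nat.cast_sub i2]; ring
        have e2 : ((n - k - 1 : ℕ) : ℝ) = n - k - 1 := by
          rw [Nat.cast_sub (by omega), Nat.cast_sub (by omega)]; push_cast; ring
        rw [← e1, ← e2]; exact_mod_cast l4
      push_cast
      have n5 : (0 : ℝ) ≤ ((n - 7).choose (k - 5) : ℕ) := Nat.cast_nonneg _
      have n6 : (0 : ℝ) ≤ ((n - 7).choose (k - 6) : ℕ) := Nat.cast_nonneg _
      generalize (((n - 7).choose (k - 5) : ℕ) : ℝ) = c5 at *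
      generalize (((n - 7).choose (k - 6) : ℕ) : ℝ) = c6 at *
      generalize ((level k 𝒜 p 5).card : ℝ) = L5 at *
      generalize ((level k 𝒜 p 6).card : ℝ) = L6 at *
      generalize ((pivot k 𝒜 p 5).card : ℝ) = V at *
      have hx : (0 : ℝ) ≤ n - k - 1 := by linarith
      have r1 := mul_le_mul_of_nonneg_right m2 hx
      have r2 : L5 * (c5 * (k - 5)) ≤ 3 * (L6 * (c6 * (n - k - 1))) := by
        rw [m4]
        have := mul_le_mul_of_nonneg_right m3 (mul_nonneg n6 hx)
        linarith
      have r3 := mul_le_mul_of_nonneg_right m1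
        (mul_nonneg n5 (show (0 : ℝ) ≤ 3 * (n - k - 1) + k - 5 by linarith))
      linarith

theorem ShiftedMaxPair.pivot_eq_of_le (h : ShiftedMaxPair k t 𝒜 ℬ p) {i j : ℕ} (ht : 3 ≤ t)
    (hk : t ≤ k) (hn : (t + 1) * (k - t + 1) ≤ n) (hp : t < p.val + 1)
    (hij : i + j = p.val + 1 + t) (hi : (pivot k 𝒜 p i).Nonempty) (hle : i ≤ j) :
    i = t + 1 ∧ j = t + 1 := by
  obtain ⟨-, i2, -⟩ := card_le_of_pivot hi
  have hti : t + 1 ≤ i := by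
    by_contra hlt
    have : i = t := by
      obtain ⟨E, hE⟩ := id hi
      have h1 := (mem_pivot.1 hE).1
      have h2 := h.le_card_gen h1.1
      omega
    subst this
    exact h.not_pivot_t hk hn hp hi
  have hs : t + 2 ≤ j → (t - 1) * (p.val + 1) < t * i := by
    intro hj
    have h1 := (h.proportion ht hn hij hi hti hle).2 hj
    have h2 := card_lower_mul_le h.shiftedLeft p i2
    have h3 : ((lower k 𝒜 p i).card : ℝ) * (p.val + 1) ≤ i * 𝒜.card := by exact_mod_cast h2
    have ha : (0 : ℝ) < 𝒜.card := by exact_mod_cast h.posLeft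
    have hq : (0 : ℝ) < p.val + 1 := by positivity
    have h4 : (((t - 1 : ℕ) * (p.val + 1 : ℕ) : ℕ) : ℝ) < (t * i : ℕ) := by
      push_cast [Nat.cast_sub (show 1 ≤ t by omega)]
      refine lt_of_mul_lt_mul_left ?_ ha.le
      have h5 := mul_lt_mul_of_pos_right h1 hq
      have h6 := mul_le_mul_of_nonneg_left h3 (Nat.cast_nonneg (α := ℝ) t)
      linarith
    exact_mod_cast h4
  rcases pivot_sizes ht hti hle hij hs with h1 | ⟨rfl, h1, rfl⟩
  · exact h1
  · exact absurd hi (h.not_pivot_five hn h1)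

theorem ShiftedMaxPair.pivot_eq (h : ShiftedMaxPair k t 𝒜 ℬ p) {i : ℕ} (ht : 3 ≤ t)
    (hk : t ≤ k) (hn : (t + 1) * (k - t + 1) ≤ n) (hp : t < p.val + 1)
    (hi : (pivot k 𝒜 p i).Nonempty) : i = t + 1 ∧ p.val + 1 = t + 2 := by
  have hi3 := (card_le_of_pivot hi).2.2
  have hij : i + (p.val + 1 + t - i) = p.val + 1 + t := by omega
  rcases le_total i (p.val + 1 + t - i) with hle | hle
  · have := h.pivot_eq_of_le ht hk hn hp hij hi hle
    omega
  · have := h.symm.pivot_eq_of_le ht hk hn hp (by omega) (h.exists_partner hij hi) hle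
    omega

/-- A trace `E` of size only `t` would avoid `p`, and `insert p E` would be the only pivot of `ℬ` of
size `t + 1`. A single pivot is too few: its level has at least two generators, so it accounts for
at most half of `ℬ`, less than the required `(t - 1)/t`. -/
theorem ShiftedMaxPair.subset_frankl (h : ShiftedMaxPair k t 𝒜 ℬ p) (ht : 3 ≤ t)
    (hk : t ≤ k) (hn : (t + 1) * (k - t + 1) ≤ n) (hp : p.val + 1 = t + 2)
    (hj : (pivot k ℬ p (t + 1)).Nonempty) : 𝒜 ⊆ frankl k (t + 1) (Finset.Iic p) := by
  intro F hF
  refine mem_frankl.2 ⟨mem_kSubsets.1 (h.max.left hF), ?_⟩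
  have hE := h.determinedLeft F hF
  have hEp : F ∩ Finset.Iic p ⊆ Finset.Iic p := Finset.inter_subset_right
  generalize F ∩ Finset.Iic p = E at *
  by_contra hlt
  have hEt : E.card = t := by
    have := h.le_card_gen hE
    omega
  have hpE : p ∉ E := by
    intro hpE
    refine h.not_pivot_t hk hn (by omega) ⟨E, mem_pivot.2 ⟨⟨hE, hEp, hEt⟩, hpE, fun h1 => ?_⟩⟩
    have h2 := h.le_card_gen h1
    rw [Finset.card_erase_of_mem hpE] at h2
    omega
  have hone : (pivot k ℬ p (t + 1)).card ≤ 1 := by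
    rw [Finset.card_le_one_iff_subset_singleton]
    refine ⟨insert p E, fun D hD => Finset.mem_singleton.2 ?_⟩
    obtain ⟨⟨h1, h2, h3⟩, h4, h5⟩ := mem_pivot.1 hD
    have h6 := h.cross_gen E hE D h1
    have h7 : E ∩ D = E :=
      Finset.eq_of_subset_of_card_le Finset.inter_subset_left (by omega)
    refine (Finset.eq_of_subset_of_card_le
      (Finset.insert_subset h4 (Finset.inter_eq_left.1 h7)) ?_).symm
    rw [Finset.card_insert_of_notMem hpE]
    omega
  obtain ⟨-, i2, -⟩ := card_le_of_pivot hj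
  have l1 := card_pivot_mul_le (k := k) (i := t + 1) h.shiftedRight p
  have l2 := card_level_le ℬ p i2
  have l3 := (h.symm.proportion ht hn (show (t + 1) + (t + 1) = p.val + 1 + t by omega) hj le_rfl
    le_rfl).1
  have l0 := Finset.card_pos.2 hj
  have e1 : (pivot k ℬ p (t + 1)).card = 1 := by omega
  rw [card_lower ℬ p i2, e1, one_mul] at l3
  rw [e1] at l1
  have l4 : 2 ≤ (level k ℬ p (t + 1)).card := by
    by_contra hlt
    have : (level k ℬ p (t + 1)).card ≤ 1 := by omega
    nlinarith
  have l5 : 2 * (n - (p.val + 1)).choose (k - (t + 1)) ≤ ℬ.card :=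
    (Nat.mul_le_mul_right _ l4).trans l2
  have l6 : (2 : ℝ) * ((n - (p.val + 1)).choose (k - (t + 1)) : ℕ) ≤ ℬ.card := by
    exact_mod_cast l5
  have hb : (0 : ℝ) < ℬ.card := by exact_mod_cast h.posRight
  have ht' : (3 : ℝ) ≤ t := by exact_mod_cast ht
  nlinarith

end MaxPair

/-! ### Structure of maximum pairs -/

/-- A family fails to be determined one step earlier only because of a pivot. -/
theorem exists_pivot {n k : ℕ} {𝒜 : Finset (Finset (Fin n))} {p q : Fin n}
    (hq : p.val = q.val + 1) (hp : Determined k 𝒜 p) (h : ¬ Determined k 𝒜 q) :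
    ∃ i, (pivot k 𝒜 p i).Nonempty := by
  unfold Determined at h
  push Not at h
  obtain ⟨F, hF, h1⟩ := h
  have h2 : (F ∩ Finset.Iic p).erase p = F ∩ Finset.Iic q := by
    ext x
    simp only [Finset.mem_erase, Finset.mem_inter, Finset.mem_Iic, Fin.le_def, ne_eq, Fin.ext_iff, hq]
    by_cases hx : x ∈ F
    · simp only [hx, true_and]; omega
    · simp only [hx, false_and, and_false]
  refine ⟨_, F ∩ Finset.Iic p,
    mem_pivot.2 ⟨⟨hp F hF, Finset.inter_subset_right, rfl⟩, ?_, by rwa [h2]⟩⟩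
  by_contra h3
  rw [Finset.erase_eq_of_notMem h3] at h2
  exact h1 (h2 ▸ hp F hF)

/-- A shifted maximum pair consists of subfamilies of a Frankl family. -/
theorem MaxCrossPair.shifted_structure {n k t : ℕ} {𝒜 ℬ : Finset (Finset (Fin n))}
    (hmax : MaxCrossPair k t 𝒜 ℬ) (h0 : 0 < 𝒜.card * ℬ.card) (h𝒜 : Shifted 𝒜) (hℬ : Shifted ℬ)
    (ht : 3 ≤ t) (hk : t + 1 ≤ k) (hn : (t + 1) * (k - t + 1) ≤ n) (h2k : 2 * k ≤ n) :
    ∃ r ≤ 1, ∃ W : Finset (Fin n), W.card = t + 2 * r ∧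
      𝒜 ⊆ frankl k (t + r) W ∧ ℬ ⊆ frankl k (t + r) W := by
  -- On the whole ground set every member is its own trace, so a least `s` exists.
  have hex : ∃ s, ∃ hs : s < n, Determined k 𝒜 ⟨s, hs⟩ ∧ Determined k ℬ ⟨s, hs⟩ := by
    have huniv : Finset.Iic (⟨n - 1, by omega⟩ : Fin n) = Finset.univ := by
      ext x; simp only [Finset.mem_Iic, Finset.mem_univ, iff_true, Fin.le_def]
      have := x.isLt
      omega
    have key : ∀ 𝒳 : Finset (Finset (Fin n)), 𝒳 ⊆ kSubsets n k →
        Determined k 𝒳 ⟨n - 1, by omega⟩ := by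
      intro 𝒳 hX F hF
      rw [huniv, Finset.inter_univ]
      have hFk := mem_kSubsets.1 (hX hF)
      refine mem_gen.2 ⟨hFk.le, fun G hG hFG => ?_⟩
      rwa [← Finset.eq_of_subset_of_card_le hFG (by omega)]
    exact ⟨n - 1, by omega, key 𝒜 hmax.left, key ℬ hmax.right⟩
  classical
  obtain ⟨hs, hd𝒜, hdℬ⟩ := Nat.find_spec hex
  have hmin := fun m => Nat.find_min hex (m := m)
  generalize Nat.find hex = s at *
  have h : ShiftedMaxPair k t 𝒜 ℬ ⟨s, hs⟩ :=
    ⟨hmax, Nat.pos_of_mul_pos_right h0, Nat.pos_of_mul_pos_left h0, h𝒜, hℬ, hd𝒜, hdℬ, h2k⟩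
  obtain ⟨F₀, hF₀⟩ := Finset.card_pos.1 h.posLeft
  have hts : t ≤ s + 1 := by
    have h1 := h.le_card_gen (hd𝒜 F₀ hF₀)
    have h2 := Finset.card_le_card (Finset.inter_subset_right (s₁ := F₀)
      (s₂ := Finset.Iic (⟨s, hs⟩ : Fin n)))
    rw [Fin.card_Iic] at h2
    exact h1.trans h2
  rcases hts.eq_or_lt with hts | hts
  · refine ⟨0, Nat.zero_le _, Finset.Iic ⟨s, hs⟩, by rw [Fin.card_Iic]; exact hts.symm, ?_, ?_⟩
    · exact fun F hF => mem_frankl.2 ⟨mem_kSubsets.1 (hmax.left hF), h.le_card_gen (hd𝒜 F hF)⟩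
    · exact fun F hF =>
        mem_frankl.2 ⟨mem_kSubsets.1 (hmax.right hF), h.symm.le_card_gen (hdℬ F hF)⟩
  have hnot : ¬ (Determined k 𝒜 (⟨s - 1, by omega⟩ : Fin n) ∧
      Determined k ℬ (⟨s - 1, by omega⟩ : Fin n)) := fun h1 =>
    hmin (s - 1) (by omega) ⟨by omega, h1⟩
  have hpq : (⟨s, hs⟩ : Fin n).val = (⟨s - 1, by omega⟩ : Fin n).val + 1 := by
    change s = s - 1 + 1; omega
  have htk : t ≤ k := by omega
  have key : s + 1 = t + 2 ∧ (pivot k 𝒜 ⟨s, hs⟩ (t + 1)).Nonempty ∧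
      (pivot k ℬ ⟨s, hs⟩ (t + 1)).Nonempty := by
    rcases not_and_or.1 hnot with h1 | h1
    · obtain ⟨i, hi⟩ := exists_pivot hpq hd𝒜 h1
      obtain ⟨rfl, h3⟩ := h.pivot_eq ht htk hn hts hi
      replace h3 : s + 1 = t + 2 := h3
      exact ⟨h3, hi, h.exists_partner (show t + 1 + (t + 1) = s + 1 + t by omega) hi⟩
    · obtain ⟨i, hi⟩ := exists_pivot hpq hdℬ h1
      obtain ⟨rfl, h3⟩ := h.symm.pivot_eq ht htk hn hts hi
      replace h3 : s + 1 = t + 2 := h3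
      exact ⟨h3, h.symm.exists_partner (show t + 1 + (t + 1) = s + 1 + t by omega) hi, hi⟩
  exact ⟨1, le_rfl, Finset.Iic ⟨s, hs⟩, by rw [Fin.card_Iic]; exact key.1,
    h.subset_frankl ht htk hn key.1 key.2.2, h.symm.subset_frankl ht htk hn key.1 key.2.1⟩

/-- A maximum pair is a pair of equal Frankl families of index `0` or `1`. -/
theorem MaxCrossPair.exists_frankl {n k t : ℕ} (ht : 3 ≤ t) (hk : t + 1 ≤ k)
    (hn : (t + 1) * (k - t + 1) ≤ n) (N : ℕ) :
    ∀ 𝒜 ℬ : Finset (Finset (Fin n)), weight 𝒜 + weight ℬ = N → MaxCrossPair k t 𝒜 ℬ →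
      0 < 𝒜.card * ℬ.card → ∃ r ≤ 1, ∃ W : Finset (Fin n), W.card = t + 2 * r ∧
        𝒜 = frankl k (t + r) W ∧ ℬ = frankl k (t + r) W := by
  obtain ⟨d, rfl⟩ : ∃ d, k = t + 1 + d := ⟨k - (t + 1), by omega⟩
  have hn' := hn
  rw [show t + 1 + d - t + 1 = d + 2 by omega] at hn'
  -- These follow from `n ≥ (t + 1)(d + 2)` and `t ≥ 3`. They give the room for extending generators
  -- and for finding common neighbours.
  have h2k : 2 * (t + 1 + d) ≤ n := by nlinarith
  have h3k : 4 * d + 2 * t + 2 ≤ n := by nlinarith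
  induction N using Nat.strong_induction_on with
  | _ N ih =>
  intro 𝒜 ℬ hN hmax h0
  have step : ∀ a b : Fin n, a < b →
      weight (shift a b 𝒜) + weight (shift a b ℬ) < weight 𝒜 + weight ℬ →
      ∃ r ≤ 1, ∃ W : Finset (Fin n), W.card = t + 2 * r ∧
        𝒜 = frankl (t + 1 + d) (t + r) W ∧ ℬ = frankl (t + 1 + d) (t + r) W := by
    intro a b hab hlt
    obtain ⟨r, hr, W, hW, h1, h2⟩ := ih _ (hN ▸ hlt) _ _ rfl (hmax.map_shift hab.ne)
      (by rwa [card_shift, card_shift])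
    obtain ⟨W', h3⟩ := hmax.frankl_of_shift h0 hab.ne hW (by omega) (by omega) (by omega) h1 h2
    exact ⟨r, hr, W', h3⟩
  by_cases h𝒜 : Shifted 𝒜
  swap
  · unfold Shifted at h𝒜
    push Not at h𝒜
    obtain ⟨a, b, hab, F, hF, hb, ha, hnot⟩ := h𝒜
    exact step a b hab
      (add_lt_add_of_lt_of_le (weight_shift_lt hab hF hb ha hnot) (weight_shift_le hab ℬ))
  by_cases hℬ : Shifted ℬ
  swap
  · unfold Shifted at hℬ
    push Not at hℬ
    obtain ⟨a, b, hab, F, hF, hb, ha, hnot⟩ := hℬ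
    exact step a b hab
      (add_lt_add_of_le_of_lt (weight_shift_le hab 𝒜) (weight_shift_lt hab hF hb ha hnot))
  obtain ⟨r, hr, W, hW, h1, h2⟩ := hmax.shifted_structure h0 h𝒜 hℬ ht hk hn h2k
  exact ⟨r, hr, W, hW,
    hmax.eq_of_subset h0 (Finset.filter_subset _ _) (frankl_cross hW) h1 h2⟩

/-! ### Sizes of the Frankl families -/

theorem frankl_eq_fullStar {n k : ℕ} (W : Finset (Fin n)) :
    frankl k W.card W = fullStar k W := by
  ext F
  simp only [frankl, fullStar, Finset.mem_filter]
  refine and_congr_right fun _ => ⟨fun h => ?_, fun h => ?_⟩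
  · exact Finset.inter_eq_right.1
      (Finset.eq_of_subset_of_card_le Finset.inter_subset_right h)
  · rw [Finset.inter_eq_right.2 h]

theorem card_fullStar {n k : ℕ} {W : Finset (Fin n)} (h : W.card ≤ k) :
    (fullStar k W).card = (n - W.card).choose (k - W.card) := by
  have h1 : fullStar k W = withTrace k W {W} := by
    ext F
    simp only [withTrace, fullStar, Finset.mem_filter, Finset.mem_singleton, Finset.inter_eq_right]
  rw [h1, card_withTrace (i := W.card) h (by simp), Finset.card_singleton, one_mul]

theorem card_frankl_one {n k t : ℕ} (hk : t + 1 ≤ k) {W : Finset (Fin n)}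
    (hW : W.card = t + 2) :
    (frankl k (t + 1) W).card =
      (t + 2) * (n - (t + 2)).choose (k - (t + 1)) + (fullStar k W).card := by
  have h1 : frankl k (t + 1) W =
      withTrace k W (Finset.powersetCard (t + 1) W) ∪ fullStar k W := by
    ext F
    simp only [mem_frankl, Finset.mem_union, mem_withTrace, Finset.mem_powersetCard,
      Finset.inter_subset_right, true_and, fullStar, Finset.mem_filter, mem_kSubsets,
      ← and_or_left]
    refine and_congr_right fun _ => ⟨fun h => ?_, fun h => ?_⟩
    · rcases h.eq_or_lt with h2 | h2
      · exact Or.inl h2.symm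
      · exact Or.inr (Finset.inter_eq_right.1
          (Finset.eq_of_subset_of_card_le Finset.inter_subset_right (by omega)))
    · rcases h with h | h
      · rw [h]
      · rw [Finset.inter_eq_right.2 h]; omega
  rw [h1, Finset.card_union_of_disjoint, card_withTrace (i := t + 1) hk,
    Finset.card_powersetCard, hW, Nat.choose_succ_self_right]
  · exact fun E hE => Finset.mem_powersetCard.1 hE
  · refine Finset.disjoint_left.2 fun F h2 h3 => ?_
    have h4 := (Finset.mem_powersetCard.1 (mem_withTrace.1 h2).2).2
    rw [Finset.inter_eq_right.2 (Finset.mem_filter.1 h3).2] at h4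
    omega

/-- The Frankl family of index `1` is at most as large as a full star, with equality only at the
threshold. -/
theorem card_frankl_one_le {n k t : ℕ} (hk : t + 1 ≤ k)
    (hn : (t + 1) * (k - t + 1) ≤ n) {W : Finset (Fin n)} (hW : W.card = t + 2) :
    (frankl k (t + 1) W).card ≤ (n - t).choose (k - t) ∧
      ((frankl k (t + 1) W).card = (n - t).choose (k - t) → n = (t + 1) * (k - t + 1)) := by
  rw [card_frankl_one hk hW]
  rcases hk.eq_or_lt with rfl | hk
  · have h1 : fullStar (t + 1) W = ∅ := by
      refine Finset.filter_eq_empty_iff.2 fun F hF hWF => ?_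
      have h2 := Finset.card_le_card hWF
      rw [mem_kSubsets.1 hF] at h2
      omega
    rw [show t + 1 - t = 1 by omega] at hn ⊢
    rw [h1, Finset.card_empty, Nat.sub_self, Nat.choose_zero_right, Nat.choose_one_right]
    omega
  · rw [card_fullStar (by omega), hW]
    obtain ⟨l, rfl⟩ : ∃ l, k = t + 2 + l := ⟨k - (t + 2), by omega⟩
    rw [show t + 2 + l - t + 1 = l + 3 by omega] at hn ⊢
    obtain ⟨m, rfl⟩ : ∃ m, n = t + 2 + m := ⟨n - (t + 2), by
      have : t + 2 ≤ n := by nlinarith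
      omega⟩
    rw [show t + 2 + m - t = m + 2 by omega, show t + 2 + l - t = l + 2 by omega,
      show t + 2 + l - (t + 1) = l + 1 by omega, Nat.add_sub_cancel_left,
      Nat.add_sub_cancel_left]
    have e1 := Nat.choose_succ_succ' (m + 1) (l + 1)
    have e2 := Nat.choose_succ_succ' m l
    have e3 := Nat.choose_succ_succ' m (l + 1)
    have e4 := Nat.choose_succ_right_eq m (l + 1)
    -- `c` is the excess of `n` over the threshold. After Pascal's rule the comparison with the star
    -- is `t * m.choose (l + 1) ≤ m.choose (l + 2)`, and `c` measures the gap.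
    obtain ⟨c, hc⟩ : ∃ c, m = l + 1 + t * (l + 2) + c :=
      ⟨m - (l + 1 + t * (l + 2)), by
        have : l + 1 + t * (l + 2) ≤ m := by nlinarith
        omega⟩
    have hpos : 0 < m.choose (l + 1) := Nat.choose_pos (by omega)
    rw [show m - (l + 1) = t * (l + 2) + c by omega] at e4
    have e5 : m.choose (l + 2) * (l + 2) = t * m.choose (l + 1) * (l + 2) + c * m.choose (l + 1) := by
      linarith
    have e6 : t * m.choose (l + 1) ≤ m.choose (l + 2) := by
      by_contra hlt
      have := Nat.mul_lt_mul_of_pos_right (not_le.1 hlt) (show 0 < l + 2 by omega)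
      have := Nat.zero_le (c * m.choose (l + 1))
      omega
    have e7 : (m + 2).choose (l + 2) =
        m.choose l + 2 * m.choose (l + 1) + m.choose (l + 2) := by
      rw [e1, e2, e3]; ring
    rw [e7]
    refine ⟨by linarith, fun h => ?_⟩
    have e8 : m.choose (l + 2) = t * m.choose (l + 1) := by linarith
    rw [e8] at e5
    have e9 : c * m.choose (l + 1) = 0 := by omega
    have hc0 : c = 0 := by
      rcases Nat.mul_eq_zero.1 e9 with h1 | h1
      · exact h1
      · omega
    rw [hc, hc0]; ring

/-! ### Existence and classification of maximum pairs -/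

theorem exists_maxCrossPair (n k t : ℕ) :
    ∃ 𝒜 ℬ : Finset (Finset (Fin n)), MaxCrossPair k t 𝒜 ℬ := by
  classical
  let S : Finset (Finset (Finset (Fin n)) × Finset (Finset (Fin n))) :=
    Finset.univ.filter fun x =>
      x.1 ⊆ kSubsets n k ∧ x.2 ⊆ kSubsets n k ∧ CrossTIntersecting t x.1 x.2
  have hS : S.Nonempty := ⟨(∅, ∅), Finset.mem_filter.2 ⟨Finset.mem_univ _,
    Finset.empty_subset _, Finset.empty_subset _, fun A hA => absurd hA (Finset.notMem_empty A)⟩⟩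
  obtain ⟨x, hx, hmax⟩ := S.exists_max_image (fun x => x.1.card * x.2.card) hS
  obtain ⟨-, h1, h2, h3⟩ := Finset.mem_filter.1 hx
  exact ⟨x.1, x.2, h1, h2, h3, fun 𝒜' ℬ' h4 h5 h6 =>
    hmax (𝒜', ℬ') (Finset.mem_filter.2 ⟨Finset.mem_univ _, h4, h5, h6⟩)⟩

theorem fullStar_cross {n k t : ℕ} {T : Finset (Fin n)} (hT : T.card = t) :
    CrossTIntersecting t (fullStar k T) (fullStar k T) := by
  intro A hA B hB
  rw [← hT]
  exact Finset.card_le_card (Finset.subset_inter (Finset.mem_filter.1 hA).2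
    (Finset.mem_filter.1 hB).2)

/-- Nonempty cross-`t`-intersecting families of `t`-sets are equal singletons. -/
theorem cross_eq_singleton {n t : ℕ} {𝒜 ℬ : Finset (Finset (Fin n))}
    (h𝒜 : 𝒜 ⊆ kSubsets n t) (hℬ : ℬ ⊆ kSubsets n t) (hc : CrossTIntersecting t 𝒜 ℬ)
    (h0 : 0 < 𝒜.card * ℬ.card) : ∃ T : Finset (Fin n), T.card = t ∧ 𝒜 = {T} ∧ ℬ = {T} := by
  have key : ∀ A ∈ 𝒜, ∀ B ∈ ℬ, A = B := by
    intro A hA B hB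
    have h1 := mem_kSubsets.1 (h𝒜 hA)
    have h2 := mem_kSubsets.1 (hℬ hB)
    have h3 := hc A hA B hB
    exact (Finset.eq_of_subset_of_card_le Finset.inter_subset_left (by omega)).symm.trans
      (Finset.eq_of_subset_of_card_le Finset.inter_subset_right (by omega))
  obtain ⟨A, hA⟩ := Finset.card_pos.1 (Nat.pos_of_mul_pos_right h0)
  obtain ⟨B, hB⟩ := Finset.card_pos.1 (Nat.pos_of_mul_pos_left h0)
  refine ⟨A, mem_kSubsets.1 (h𝒜 hA), Finset.eq_singleton_iff_unique_mem.2 ⟨hA, fun F hF => ?_⟩,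
    Finset.eq_singleton_iff_unique_mem.2 ⟨key A hA B hB ▸ hB, fun F hF => (key A hA F hF).symm⟩⟩
  rw [key F hF B hB, key A hA B hB]

theorem fullStar_self {n : ℕ} (T : Finset (Fin n)) : fullStar T.card T = {T} := by
  ext F
  simp only [fullStar, Finset.mem_filter, mem_kSubsets, Finset.mem_singleton]
  constructor
  · rintro ⟨h1, h2⟩
    exact (Finset.eq_of_subset_of_card_le h2 h1.le).symm
  · rintro rfl
    exact ⟨rfl, subset_rfl⟩

theorem choose_pos_of_bounds {n k t : ℕ} (hkn : k ≤ n) : 0 < (n - t).choose (k - t) :=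
  Nat.choose_pos (by omega)

theorem star_le_max {n k t : ℕ} (htk : t ≤ k) (hkn : k ≤ n) {𝒜 ℬ : Finset (Finset (Fin n))}
    (h : MaxCrossPair k t 𝒜 ℬ) : (n - t).choose (k - t) ^ 2 ≤ 𝒜.card * ℬ.card := by
  obtain ⟨T, -, hT⟩ := Finset.exists_subset_card_eq
    (show t ≤ (Finset.univ : Finset (Fin n)).card by rw [Finset.card_fin]; omega)
  have h1 := h.max (fullStar k T) (fullStar k T) (Finset.filter_subset _ _)
    (Finset.filter_subset _ _) (fullStar_cross hT)
  rw [card_fullStar (by omega), hT] at h1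
  rwa [sq]

/-- A maximum pair attains the square of the size of a full star, both families are equal, and
they are full stars beyond the threshold. -/
theorem MaxCrossPair.classification {n k t : ℕ} (ht : 3 ≤ t) (htk : t ≤ k) (hkn : k ≤ n)
    (hn : (t + 1) * (k - t + 1) ≤ n) {𝒜 ℬ : Finset (Finset (Fin n))}
    (h : MaxCrossPair k t 𝒜 ℬ) :
    𝒜.card * ℬ.card = (n - t).choose (k - t) ^ 2 ∧ 𝒜 = ℬ ∧
      ((t + 1) * (k - t + 1) < n → ∃ T : Finset (Fin n), T.card = t ∧ 𝒜 = fullStar k T) := by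
  have hstar := star_le_max htk hkn h
  have h0 : 0 < 𝒜.card * ℬ.card :=
    lt_of_lt_of_le (pow_pos (choose_pos_of_bounds hkn) 2) hstar
  rcases htk.eq_or_lt with rfl | hk
  -- For `k = t` the hypothesis only gives `n ≥ t + 1`, not the `2 * k ≤ n` used for generators.
  · obtain ⟨T, hT, rfl, rfl⟩ := cross_eq_singleton h.left h.right h.cross h0
    refine ⟨by simp, rfl, fun _ => ⟨T, hT, ?_⟩⟩
    rw [← hT, fullStar_self]
  obtain ⟨r, hr, W, hW, hA, hB⟩ := MaxCrossPair.exists_frankl ht hk hn _ 𝒜 ℬ rfl h h0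
  have hAB : 𝒜 = ℬ := hA.trans hB.symm
  subst hAB
  interval_cases r
  · have h1 : 𝒜 = fullStar k W := by
      rw [hA, ← frankl_eq_fullStar, hW]
    refine ⟨?_, rfl, fun _ => ⟨W, hW, h1⟩⟩
    rw [h1, card_fullStar (by omega), hW, sq]
    rfl
  · obtain ⟨h1, h2⟩ := card_frankl_one_le hk hn (W := W) hW
    rw [← hA] at h1 h2
    rw [sq] at hstar
    have h3 : 𝒜.card = (n - t).choose (k - t) := by
      refine le_antisymm h1 ?_
      by_contra h4
      nlinarith
    exact ⟨by rw [h3, sq], rfl, fun h4 => absurd (h2 h3) h4.ne'⟩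

theorem theorem1p6 (n k t : ℕ) (ht : 3 ≤ t) (htk : t ≤ k) (hkn : k ≤ n)
    (hn : (t + 1) * (k - t + 1) ≤ n)
    (𝒜 ℬ : Finset (Finset (Fin n)))
    (h𝒜 : 𝒜 ⊆ kSubsets n k) (hℬ : ℬ ⊆ kSubsets n k)
    (hcross : CrossTIntersecting t 𝒜 ℬ) :
    𝒜.card * ℬ.card ≤ ((n - t).choose (k - t)) ^ 2 ∧
    (𝒜.card * ℬ.card = ((n - t).choose (k - t)) ^ 2 ↔
      𝒜 = ℬ ∧ IsMaximumTIntersecting k t 𝒜) ∧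
    ((t + 1) * (k - t + 1) < n →
      (𝒜.card * ℬ.card = ((n - t).choose (k - t)) ^ 2 ↔
        ∃ T : Finset (Fin n), T.card = t ∧ 𝒜 = fullStar k T ∧ ℬ = fullStar k T)) := by
  have bound : ∀ 𝒳 𝒴 : Finset (Finset (Fin n)), 𝒳 ⊆ kSubsets n k → 𝒴 ⊆ kSubsets n k →
      CrossTIntersecting t 𝒳 𝒴 → 𝒳.card * 𝒴.card ≤ ((n - t).choose (k - t)) ^ 2 := by
    intro 𝒳 𝒴 h1 h2 h3
    obtain ⟨𝒜', ℬ', h⟩ := exists_maxCrossPair n k t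
    rw [← (h.classification ht htk hkn hn).1]
    exact h.max 𝒳 𝒴 h1 h2 h3
  have max_of_eq : 𝒜.card * ℬ.card = ((n - t).choose (k - t)) ^ 2 → MaxCrossPair k t 𝒜 ℬ :=
    fun h => ⟨h𝒜, hℬ, hcross, fun 𝒜' ℬ' h1 h2 h3 => h ▸ bound 𝒜' ℬ' h1 h2 h3⟩
  refine ⟨bound 𝒜 ℬ h𝒜 hℬ hcross, ⟨fun h => ?_, ?_⟩, fun hlt => ⟨fun h => ?_, ?_⟩⟩
  · obtain ⟨-, rfl, -⟩ := (max_of_eq h).classification ht htk hkn hn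
    refine ⟨rfl, h𝒜, hcross, fun 𝒢 h1 h2 => ?_⟩
    -- A `t`-intersecting family is cross-`t`-intersecting with itself, so the product bound
    -- compares squares of sizes.
    have h3 := bound 𝒢 𝒢 h1 h1 h2
    rw [← h] at h3
    exact Nat.mul_self_le_mul_self_iff.1 h3
  · rintro ⟨rfl, h1, h2, h3⟩
    refine le_antisymm (bound 𝒜 𝒜 h𝒜 hℬ hcross) ?_
    obtain ⟨T, -, hT⟩ := Finset.exists_subset_card_eq
      (show t ≤ (Finset.univ : Finset (Fin n)).card by rw [Finset.card_fin]; omega)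
    have h4 := h3 (fullStar k T) (Finset.filter_subset _ _) (fullStar_cross hT)
    rw [card_fullStar (by omega), hT] at h4
    rw [sq]
    exact Nat.mul_le_mul h4 h4
  · obtain ⟨-, rfl, h1⟩ := (max_of_eq h).classification ht htk hkn hn
    obtain ⟨T, hT, h2⟩ := h1 hlt
    exact ⟨T, hT, h2, h2⟩
  · rintro ⟨T, hT, rfl, rfl⟩
    rw [card_fullStar (by omega), hT, sq]
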